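/- Let $V=V_0\oplus V_1$ be a finite-dimensional real supervector space of dimension $(m,n)$ with a symplectic form $B$ (an even non-degenerate bilinear form, alternating on $V_0$ and symmetric on $V_1$) and an orientation of $V_1$, and let $\mathfrak{spo}(V)$ be the Lie superalgebra of endomorphisms of $V$ leaving $B$ invariant. Let $d_V$ be the Liouville integral of $V$: in an oriented symplectic basis, with dual coordinates $(x,\xi)$, it is $(2\pi)^{-m/2}|dx^1\cdots dx^m|$ on $V_0$ times the Berezin integral $\varphi\mapsto\frac{\partial}{\partial\xi^1}\cdots\frac{\partial}{\partial\xi^n}\varphi$ on $V_1$. Let $\mathcal V^+\subset\mathfrak{spo}(V)_0$ be the open convex cone of those $Y$ for which the quadratic form $v\mapsto B(v,Yv)$ on $V_0$ is positive definite. For a near superalgebra $\mathcal P$ (a supercommutative, finite-dimensional, local real superalgebra with residue field $\mathbb R$), write $\mathfrak{spo}(V\otimes\mathbb C)_{\mathcal P}(\mathcal V^+\times i\,\mathfrak{spo}(V))$ for the set of even elements of $\mathfrak{spo}(V)\otimes\mathcal P\otimes\mathbb C$ whose body lies in $\mathcal V^++i\,\mathfrak{spo}(V)_0$. On these points the superPfaffian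 is given by $$\operatorname{Spf}(X)=\int_V d_V(v)\,\exp\!\big(-\tfrac12 B(v,Xv)\big)\in\mathcal P\otimes\mathbb C .$$ Then $\operatorname{Spf}$ is homogeneous of degree $\frac{n-m}{2}$ on $\mathcal V^+\times i\,\mathfrak{spo}(V)$: for every near superalgebra $\mathcal P$, every $X\in\mathfrak{spo}(V\otimes\mathbb C)_{\mathcal P}(\mathcal V^+\times i\,\mathfrak{spo}(V))$ and every real $\lambda>0$, the integral defining $\operatorname{Spf}(X)$ converges, $\lambda X$ is again in $\mathfrak{spo}(V\otimes\mathbb C)_{\mathcal P}(\mathcal V^+\times i\,\mathfrak{spo}(V))$, and $$\operatorname{Spf}(\lambda X)=\lambda^{\frac{n-m}{2}}\operatorname{Spf}(X).$$ -/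

import Mathlib

open scoped TensorProduct

noncomputable section

namespace SuperPfaffian

/-! ## Near superalgebras -/

section Near

variable {P : Type*} [Ring P] [Algebra ℝ P]

/-- A real superalgebra `P = 𝒢 0 ⊕ 𝒢 1` is a *near superalgebra* if it is (super)commutative,
finite dimensional and local, with residue field `ℝ`. For a local `ℝ`-algebra, having residue
field `ℝ` amounts to the existence of an `ℝ`-algebra homomorphism onto `ℝ`; its kernel is then
the maximal ideal, and so the homomorphism is unique. -/
class IsNear (𝒢 : ZMod 2 → Submodule ℝ P) [GradedAlgebra 𝒢] : Prop where
  superComm : ∀ (i j : ZMod 2) (a b : P), a ∈ 𝒢 i → b ∈ 𝒢 j →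
    a * b = ((-1 : ℝ) ^ (i.val * j.val)) • (b * a)
  finite : Module.Finite ℝ P
  isLocal : IsLocalRing P
  residue : Nonempty (P →ₐ[ℝ] ℝ)

/-- The body `b : P → ℝ`, the canonical projection onto the residue field. -/
def body (𝒢 : ZMod 2 → Submodule ℝ P) [GradedAlgebra 𝒢] [h : IsNear 𝒢] : P →ₐ[ℝ] ℝ :=
  Classical.choice h.residue

end Near

section Symplectic

variable {V : Type*} [AddCommGroup V] [Module ℝ V]

/-! ## Symplectic supervector spaces -/

/-- `B` is a symplectic form on the supervector space `V = 𝒱 0 ⊕ 𝒱 1`: the even and odd parts are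
orthogonal, `B` is alternating on `𝒱 0`, symmetric on `𝒱 1`, and non-degenerate. -/
structure IsSymplecticForm (𝒱 : ZMod 2 → Submodule ℝ V) (B : LinearMap.BilinForm ℝ V) : Prop where
  even_odd : ∀ v ∈ 𝒱 0, ∀ w ∈ 𝒱 1, B v w = 0
  odd_even : ∀ v ∈ 𝒱 1, ∀ w ∈ 𝒱 0, B v w = 0
  alternating : ∀ v ∈ 𝒱 0, B v v = 0
  symmetric : ∀ v ∈ 𝒱 1, ∀ w ∈ 𝒱 1, B v w = B w v
  nondegenerate : B.Nondegenerate

/-- A symplectic basis `(e_1, e_2), (e_3, e_4), …` of the even part: the pairs are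
`(e (i, 0), e (i, 1))`. -/
structure EvenSymplecticBasis (𝒱 : ZMod 2 → Submodule ℝ V) (B : LinearMap.BilinForm ℝ V)
    (k : ℕ) where
  e : Module.Basis (Fin k × Fin 2) ℝ (𝒱 0)
  pair : ∀ i j, B (e (i, 0)) (e (j, 1)) = if i = j then 1 else 0
  isotropic : ∀ i j a, B (e (i, a)) (e (j, a)) = 0

/-- A symplectic basis `(f_1, …, f_n)` of the odd part: an orthonormal basis of
`𝒱 1 ⊗ ℂ` consisting of vectors of `𝒱 1 ∪ i 𝒱 1`. It is written `f j = c j • u j` with `u` a basis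
of `𝒱 1` and `c j ∈ {1, i}`. With `ξ` its dual basis, it determines the orientation `ξ¹ ⋯ ξⁿ`. -/
structure OddSymplecticBasis (𝒱 : ZMod 2 → Submodule ℝ V) (B : LinearMap.BilinForm ℝ V)
    (n : ℕ) where
  u : Module.Basis (Fin n) ℝ (𝒱 1)
  c : Fin n → ℂ
  phase : ∀ j, c j = 1 ∨ c j = Complex.I
  orthonormal : ∀ i j, c i * c j * (B (u i) (u j) : ℂ) = if i = j then 1 else 0

/-! ## The Lie superalgebra `spo(V)` and its points -/

/-- The homogeneous component of parity `a` of `spo(V)`: the endomorphisms `X` of parity `a` with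
`B(X v, w) + (-1)^{a p(v)} B(v, X w) = 0`. -/
def spo (𝒱 : ZMod 2 → Submodule ℝ V) (B : LinearMap.BilinForm ℝ V) (a : ZMod 2) :
    Submodule ℝ (Module.End ℝ V) where
  carrier := {X | (∀ i, ∀ v ∈ 𝒱 i, X v ∈ 𝒱 (i + a)) ∧
    ∀ i, ∀ v ∈ 𝒱 i, ∀ w, B (X v) w + (-1 : ℝ) ^ (a.val * i.val) * B v (X w) = 0}
  zero_mem' := by simp
  add_mem' := by
    rintro X Y ⟨h1, h2⟩ ⟨h3, h4⟩
    refine ⟨fun i v hv => add_mem (h1 i v hv) (h3 i v hv), fun i v hv w => ?_⟩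
    have := h2 i v hv w
    have := h4 i v hv w
    simp only [LinearMap.add_apply, map_add]
    linarith
  smul_mem' := by
    rintro r X ⟨h1, h2⟩
    refine ⟨fun i v hv => Submodule.smul_mem _ _ (h1 i v hv), fun i v hv w => ?_⟩
    have h := congrArg (r * ·) (h2 i v hv w)
    simp only [LinearMap.smul_apply, map_smul, smul_eq_mul]
    linarith

/-- The open cone `𝒱⁺` of `spo(V)_0`: those `Y` for which the quadratic form `v ↦ B(v, Y v)` on
`𝒱 0` is positive definite. -/
def posCone (𝒱 : ZMod 2 → Submodule ℝ V) (B : LinearMap.BilinForm ℝ V) :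
    Set (Module.End ℝ V) :=
  {Y | Y ∈ spo 𝒱 B 0 ∧ ∀ v ∈ 𝒱 0, v ≠ 0 → 0 < B v (Y v)}

variable {P : Type*} [Ring P] [Algebra ℝ P]

/-- The points of `spo(V ⊗ ℂ)` with values in `P`, that is the complexification of the even part
`spo(V)_0 ⊗ P_0 ⊕ spo(V)_1 ⊗ P_1` of `spo(V) ⊗ P`. -/
def spoPoints (𝒱 : ZMod 2 → Submodule ℝ V) (B : LinearMap.BilinForm ℝ V)
    (𝒢 : ZMod 2 → Submodule ℝ P) : Submodule ℂ (ℂ ⊗[ℝ] (Module.End ℝ V ⊗[ℝ] P)) :=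
  (⨆ a, LinearMap.range (TensorProduct.map (spo 𝒱 B a).subtype (𝒢 a).subtype)).baseChange ℂ

/-- The body `gl(V ⊗ ℂ)_P → gl(V ⊗ ℂ)` of a point. -/
def pointBody (𝒢 : ZMod 2 → Submodule ℝ P) [GradedAlgebra 𝒢] [IsNear 𝒢] :
    ℂ ⊗[ℝ] (Module.End ℝ V ⊗[ℝ] P) →ₗ[ℂ] ℂ ⊗[ℝ] Module.End ℝ V :=
  ((TensorProduct.rid ℝ (Module.End ℝ V)).toLinearMap ∘ₗ
    (body 𝒢).toLinearMap.lTensor (Module.End ℝ V)).baseChange ℂ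

/-- The set `spo(V ⊗ ℂ)_P(𝒱⁺ × i spo(V))` of the `P`-points of `spo(V ⊗ ℂ)` whose body lies in the
tube `𝒱⁺ + i spo(V)_0`. -/
def tubePoints (𝒱 : ZMod 2 → Submodule ℝ V) (B : LinearMap.BilinForm ℝ V)
    (𝒢 : ZMod 2 → Submodule ℝ P) [GradedAlgebra 𝒢] [IsNear 𝒢] :
    Set (ℂ ⊗[ℝ] (Module.End ℝ V ⊗[ℝ] P)) :=
  {X | X ∈ spoPoints 𝒱 B 𝒢 ∧ ∃ Y ∈ posCone 𝒱 B, ∃ Z ∈ spo 𝒱 B 0,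
    pointBody 𝒢 X = (1 : ℂ) ⊗ₜ[ℝ] Y + Complex.I ⊗ₜ[ℝ] Z}

/-! ## Functions of the odd variables -/

/-- The exterior algebra `Λ(V_1^*)`. -/
abbrev OddFunctions (𝒱 : ZMod 2 → Submodule ℝ V) : Type _ :=
  ExteriorAlgebra ℝ (Module.Dual ℝ (𝒱 1))

/-- The `ℤ/2`-grading of `Λ(V_1^*)`. -/
abbrev oddGrading (𝒱 : ZMod 2 → Submodule ℝ V) : ZMod 2 → Submodule ℝ (OddFunctions 𝒱) :=
  CliffordAlgebra.evenOdd (0 : QuadraticForm ℝ (Module.Dual ℝ (𝒱 1)))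

/-- The superalgebra `Λ(V_1^*) ⊗ P`, with product given by the rule of signs. -/
abbrev RealCoeff (𝒱 : ZMod 2 → Submodule ℝ V) (𝒢 : ZMod 2 → Submodule ℝ P)
    [GradedAlgebra 𝒢] : Type _ :=
  GradedTensorProduct ℝ (oddGrading 𝒱) 𝒢

/-- Its complexification `Λ(V_1^*) ⊗ P ⊗ ℂ`. A `P_ℂ`-valued function on the supermanifold `V` is a
function on `𝒱 0` with values in this algebra. -/
abbrev Coeff (𝒱 : ZMod 2 → Submodule ℝ V) (𝒢 : ZMod 2 → Submodule ℝ P)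
    [GradedAlgebra 𝒢] : Type _ :=
  ℂ ⊗[ℝ] RealCoeff 𝒱 𝒢

/-- The body `Λ(V_1^*) ⊗ P ⊗ ℂ → ℂ`. -/
def coeffBody (𝒱 : ZMod 2 → Submodule ℝ V) (𝒢 : ZMod 2 → Submodule ℝ P)
    [GradedAlgebra 𝒢] [IsNear 𝒢] : Coeff 𝒱 𝒢 →ₗ[ℂ] ℂ :=
  (TensorProduct.AlgebraTensorModule.rid ℝ ℂ ℂ).toLinearMap ∘ₗ
    ((TensorProduct.lid ℝ ℝ).toLinearMap ∘ₗ
      TensorProduct.map (ExteriorAlgebra.algebraMapInv (M := Module.Dual ℝ (𝒱 1))).toLinearMap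
        (body 𝒢).toLinearMap ∘ₗ
      (GradedTensorProduct.of ℝ (oddGrading 𝒱) 𝒢).symm.toLinearMap).baseChange ℂ

/-- `exp(α) = e^{b(α)} ∑_k (α - b(α))^k / k!`, for `α` with nilpotent soul `α - b(α)`. -/
def superExp (𝒱 : ZMod 2 → Submodule ℝ V) (𝒢 : ZMod 2 → Submodule ℝ P)
    [GradedAlgebra 𝒢] [IsNear 𝒢] (α : Coeff 𝒱 𝒢) : Coeff 𝒱 𝒢 :=
  Complex.exp (coeffBody 𝒱 𝒢 α) •
    IsNilpotent.exp (α - algebraMap ℂ (Coeff 𝒱 𝒢) (coeffBody 𝒱 𝒢 α))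

/-! ## The generic point and the quadratic function `B(v, X v)` -/

variable {𝒱 : ZMod 2 → Submodule ℝ V} {B : LinearMap.BilinForm ℝ V} {k n : ℕ}

/-- The real homogeneous basis `(e, u)` of `V`. -/
def realBasis (e : EvenSymplecticBasis 𝒱 B k) (f : OddSymplecticBasis 𝒱 B n) :
    (Fin k × Fin 2) ⊕ Fin n → V :=
  Sum.elim (fun i => (e.e i : V)) (fun j => (f.u j : V))

/-- The coordinates of the generic point `v = ∑ g_i z^i` of `V` in the basis `g = (e, u)`, above
the point of `𝒱 0` with coordinates `x`: the even ones are the numbers `x^i`, and the odd ones are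
the elements of the dual basis of `u`, as generators of `Λ(V_1^*)`. -/
def genericCoord (𝒢 : ZMod 2 → Submodule ℝ P) [GradedAlgebra 𝒢]
    (f : OddSymplecticBasis 𝒱 B n) (x : Fin k × Fin 2 → ℝ) :
    (Fin k × Fin 2) ⊕ Fin n → RealCoeff 𝒱 𝒢 :=
  Sum.elim (fun i => algebraMap ℝ (RealCoeff 𝒱 𝒢) (x i))
    (fun j => GradedTensorProduct.includeLeft (oddGrading 𝒱) 𝒢
      (ExteriorAlgebra.ι ℝ (f.u.coord j)))

/-- The function `X ↦ B(v, X v)`, with `v = ∑ g_i z^i` the generic point of `V`: for `X = G ⊗ p` it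
is `∑_{i,j} B(g_i, G g_j) z^j p z^i`, which is the extension of scalars of `B` under the rule of
signs. -/
def quadReal (𝒢 : ZMod 2 → Submodule ℝ P) [GradedAlgebra 𝒢]
    (e : EvenSymplecticBasis 𝒱 B k) (f : OddSymplecticBasis 𝒱 B n) (x : Fin k × Fin 2 → ℝ) :
    Module.End ℝ V ⊗[ℝ] P →ₗ[ℝ] RealCoeff 𝒱 𝒢 :=
  TensorProduct.lift <| LinearMap.mk₂ ℝ
    (fun G p => ∑ i, ∑ j, B (realBasis e f i) (G (realBasis e f j)) •
      (genericCoord 𝒢 f x j * GradedTensorProduct.includeRight (oddGrading 𝒱) 𝒢 p *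
        genericCoord 𝒢 f x i))
    (fun G G' p => by simp [add_smul, Finset.sum_add_distrib])
    (fun r G p => by simp [mul_smul, Finset.smul_sum])
    (fun G p p' => by simp only [map_add, mul_add, add_mul, smul_add, Finset.sum_add_distrib])
    (fun r G p => by simp [smul_comm _ r, Finset.smul_sum])

/-- The complex linear extension of `X ↦ B(v, X v)`. -/
def quad (𝒢 : ZMod 2 → Submodule ℝ P) [GradedAlgebra 𝒢]
    (e : EvenSymplecticBasis 𝒱 B k) (f : OddSymplecticBasis 𝒱 B n) (x : Fin k × Fin 2 → ℝ) :
    ℂ ⊗[ℝ] (Module.End ℝ V ⊗[ℝ] P) →ₗ[ℂ] Coeff 𝒱 𝒢 :=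
  (quadReal 𝒢 e f x).baseChange ℂ

/-! ## Berezin integration -/

/-- `φ ↦ (∂/∂θ¹ ⋯ ∂/∂θⁿ φ)_ℝ` on `Λ(V_1^*)`, with `θ` the dual basis of `u`; the odd derivation
`∂/∂θʲ` is the contraction by `u j`. -/
def topDeriv (f : OddSymplecticBasis 𝒱 B n) : OddFunctions 𝒱 →ₗ[ℝ] ℝ :=
  (ExteriorAlgebra.algebraMapInv (M := Module.Dual ℝ (𝒱 1))).toLinearMap ∘ₗ
    ((List.ofFn fun j : Fin n =>
      (CliffordAlgebra.contractLeft (Q := (0 : QuadraticForm ℝ (Module.Dual ℝ (𝒱 1))))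
        (Module.Dual.eval ℝ (𝒱 1) (f.u j)) : Module.End ℝ (OddFunctions 𝒱))).prod)

/-- The Berezin integral `∫_{V_1} d_ξ` over the odd variables, with values in `P_ℂ = ℂ ⊗ P`, for the
dual basis `ξ` of the symplectic basis `f j = c j • u j`; thus `∂/∂ξʲ = c j ∂/∂θʲ`. -/
def oddIntegral (𝒢 : ZMod 2 → Submodule ℝ P) [GradedAlgebra 𝒢]
    (f : OddSymplecticBasis 𝒱 B n) : Coeff 𝒱 𝒢 →ₗ[ℂ] ℂ ⊗[ℝ] P :=
  (∏ j, f.c j) •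
    ((TensorProduct.lid ℝ P).toLinearMap ∘ₗ (topDeriv f).rTensor P ∘ₗ
      (GradedTensorProduct.of ℝ (oddGrading 𝒱) 𝒢).symm.toLinearMap).baseChange ℂ

end Symplectic

section VectorIntegral

variable {W : Type*} [AddCommGroup W] [Module ℂ W] {α : Type*} [MeasureTheory.MeasureSpace α]

/-- Integrability of a function with values in a finite dimensional complex vector space. -/
def VIntegrable (F : α → W) : Prop :=
  ∀ l : Module.Dual ℂ W, MeasureTheory.Integrable fun x => l (F x)

/-- The integral of a function with values in a finite dimensional complex vector space, computed
on the coordinates in a basis. -/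
def vIntegral [Module.Finite ℂ W] (F : α → W) : W :=
  ∑ i, (∫ x, (Module.finBasis ℂ W).repr (F x) i) • Module.finBasis ℂ W i

end VectorIntegral

section Spf

variable {V : Type*} [AddCommGroup V] [Module ℝ V]
variable {𝒱 : ZMod 2 → Submodule ℝ V} {B : LinearMap.BilinForm ℝ V} {k n : ℕ}
variable {P : Type*} [Ring P] [Algebra ℝ P]

/-- The function `∫_{V_1} d_{V_1} exp(-½ B(v, X v))` of the even variables `x` on `V_0`. -/
def spfIntegrand (𝒢 : ZMod 2 → Submodule ℝ P) [GradedAlgebra 𝒢] [IsNear 𝒢]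
    (e : EvenSymplecticBasis 𝒱 B k) (f : OddSymplecticBasis 𝒱 B n)
    (X : ℂ ⊗[ℝ] (Module.End ℝ V ⊗[ℝ] P)) (x : Fin k × Fin 2 → ℝ) : ℂ ⊗[ℝ] P :=
  oddIntegral 𝒢 f (superExp 𝒱 𝒢 (-(1 / 2 : ℂ) • quad 𝒢 e f x X))

/-- The value in `P_ℂ = ℂ ⊗ P` of the superPfaffian at a point `X`,
`Spf(X) = ∫_V d_V(v) exp(-½ B(v, X v))`. Here `d_V` is the Liouville integral: Lebesgue measure in
symplectic coordinates times `(2π)^{-m/2}` on `V_0`, where `m = 2 k = dim V_0`, and the Berezin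
integral of the oriented symplectic basis `f` on `V_1`. -/
def spf (𝒢 : ZMod 2 → Submodule ℝ P) [GradedAlgebra 𝒢] [IsNear 𝒢]
    (e : EvenSymplecticBasis 𝒱 B k) (f : OddSymplecticBasis 𝒱 B n)
    (X : ℂ ⊗[ℝ] (Module.End ℝ V ⊗[ℝ] P)) : ℂ ⊗[ℝ] P :=
  haveI : Module.Finite ℝ P := IsNear.finite 𝒢
  (((2 * Real.pi) ^ k)⁻¹ : ℝ) • vIntegral (spfIntegrand 𝒢 e f X)

end Spf

end SuperPfaffian

end

/-! The function `B(v, X v)` is quadratic in the generic point `v`. Hence replacing `X` by `s² X`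
amounts to dilating all coordinates by `s`, the even ones as well as the odd generators. Under this
dilation Lebesgue measure on `𝒱 0` contributes `s⁻ᵐ`. The Berezin integral contributes `sⁿ`, with
the opposite exponent because it is a derivative. With `s = √r` the total factor is `r^((n-m)/2)`.
The identity of integrands is `spfIntegrand_sq_smul`, which rests on `rescale_quad`,
`superExp_rescale` and `oddIntegral_rescale`. The even Jacobian is `vIntegral_smul_comp_smul`.

For convergence, split `B(v, X v)` into body and soul. The body is `B(v, Y v) + i B(v, Z v)` with
`Y` positive definite, so its exponential is dominated by a Gaussian. The soul is a combination of
central nilpotent elements with coefficients of temperate growth (`quad_sub_mem`). It is therefore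
nilpotent with an exponent independent of `x`, and its exponential is a finite sum that also has
temperate growth. A Gaussian times such a function is integrable. -/

namespace SuperPfaffian

/-! ## Gaussian integrals of functions of temperate growth -/

section Analysis

/-- With `M = N + 1`, it suffices to bound `1 + t` by a multiple of `exp (c t² / M)` and raise to
the power `M`. Completing the square gives `t ≤ c t² / M + M / (4 c)`, and `1 + y ≤ exp y` does the
rest. The exponent `N + 1` keeps `M` positive. -/
theorem one_add_pow_le_mul_exp_sq {c : ℝ} (hc : 0 < c) (N : ℕ) :
    ∃ K : ℝ, ∀ t : ℝ, 0 ≤ t → (1 + t) ^ (N + 1) ≤ K * Real.exp (c * t ^ 2) := by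
  set M : ℝ := N + 1 with hM
  have hM0 : 0 < M := by positivity
  refine ⟨(1 + M / (4 * c)) ^ (N + 1), fun t ht => ?_⟩
  have h1 : 1 + t ≤ (1 + M / (4 * c)) * Real.exp (c / M * t ^ 2) := by
    have h2 : t ≤ c / M * t ^ 2 + M / (4 * c) := by
      have h3 : c / M * t ^ 2 + M / (4 * c) - t = c / M * (t - M / (2 * c)) ^ 2 := by
        field_simp
        ring
      have : 0 ≤ c / M * (t - M / (2 * c)) ^ 2 := by positivity
      linarith
    have h4 := Real.add_one_le_exp (c / M * t ^ 2)
    have h5 : 0 ≤ M / (4 * c) := by positivity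
    have h6 : 0 ≤ M / (4 * c) * (c / M * t ^ 2) := by positivity
    calc 1 + t ≤ (1 + M / (4 * c)) * (c / M * t ^ 2 + 1) := by nlinarith
      _ ≤ _ := by gcongr
  calc (1 + t) ^ (N + 1) ≤ ((1 + M / (4 * c)) * Real.exp (c / M * t ^ 2)) ^ (N + 1) := by gcongr
    _ = _ := by
      rw [mul_pow, ← Real.exp_nat_mul]
      congr 2
      push_cast
      rw [← hM]
      field_simp

/-- The Gaussian absorbs both the polynomial bound on `m` and a further factor `(1 + ‖x‖)^(dim E +
1)`, so the product is dominated by the integrable function `(1 + ‖x‖)^(-(dim E + 1))`. -/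
theorem integrable_exp_mul_of_hasTemperateGrowth {E : Type*} [NormedAddCommGroup E]
    [NormedSpace ℝ E] [FiniteDimensional ℝ E] [MeasureTheory.MeasureSpace E] [BorelSpace E]
    [(MeasureTheory.volume : MeasureTheory.Measure E).IsAddHaarMeasure]
    {m b : E → ℂ} (hm : m.HasTemperateGrowth) (hb : Continuous b) {c : ℝ} (hc : 0 < c)
    (hbc : ∀ x, (b x).re ≤ -(c * ‖x‖ ^ 2)) :
    MeasureTheory.Integrable fun x => Complex.exp (b x) * m x := by
  obtain ⟨M, C, hC⟩ := hm.2 0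
  have hC0 : 0 ≤ C := by
    have := (norm_nonneg _).trans (hC 0)
    simpa using this
  obtain ⟨K, hK⟩ := one_add_pow_le_mul_exp_sq hc (M + Module.finrank ℝ E)
  have hint := integrable_one_add_norm (E := E) (μ := MeasureTheory.volume)
    (r := (Module.finrank ℝ E : ℝ) + 1) (by linarith)
  refine (hint.const_mul (C * K)).mono' ?_ (Filter.Eventually.of_forall fun x => ?_)
  · have := hm.1.continuous
    exact Continuous.aestronglyMeasurable (by fun_prop)
  · have h1 : ‖m x‖ ≤ C * (1 + ‖x‖) ^ M := by simpa using hC x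
    have hp : (0 : ℝ) < 1 + ‖x‖ := by positivity
    have h2 : (1 + ‖x‖) ^ (-((Module.finrank ℝ E : ℝ) + 1)) =
        ((1 + ‖x‖) ^ (Module.finrank ℝ E + 1))⁻¹ := by
      rw [Real.rpow_neg hp.le, ← Real.rpow_natCast]
      push_cast
      rfl
    rw [h2, norm_mul, Complex.norm_exp, ← div_eq_mul_inv, le_div_iff₀ (by positivity)]
    calc Real.exp (b x).re * ‖m x‖ * (1 + ‖x‖) ^ (Module.finrank ℝ E + 1)
        ≤ Real.exp (-(c * ‖x‖ ^ 2)) * (C * (1 + ‖x‖) ^ M) *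
          (1 + ‖x‖) ^ (Module.finrank ℝ E + 1) := by
            gcongr
            exact hbc x
      _ = C * (Real.exp (-(c * ‖x‖ ^ 2)) * (1 + ‖x‖) ^ (M + Module.finrank ℝ E + 1)) := by ring
      _ ≤ C * (Real.exp (-(c * ‖x‖ ^ 2)) * (K * Real.exp (c * ‖x‖ ^ 2))) := by
            gcongr
            exact hK _ (norm_nonneg _)
      _ = C * K := by
            rw [mul_left_comm (Real.exp _), ← Real.exp_add]
            simp

/-- A continuous function, homogeneous of degree two and positive away from the origin, dominates a
multiple of the square of the norm. -/
theorem exists_mul_norm_sq_le {E : Type*} [NormedAddCommGroup E] [NormedSpace ℝ E]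
    [FiniteDimensional ℝ E] {q : E → ℝ} (hq : Continuous q)
    (hom : ∀ (t : ℝ) x, q (t • x) = t ^ 2 * q x) (pos : ∀ x, x ≠ 0 → 0 < q x) :
    ∃ c : ℝ, 0 < c ∧ ∀ x, c * ‖x‖ ^ 2 ≤ q x := by
  have h0 : q 0 = 0 := by simpa using hom 0 0
  rcases subsingleton_or_nontrivial E with hE | hE
  -- The unit sphere of the zero space is empty, so no minimum is available, but any constant works.
  · refine ⟨1, one_pos, fun x => ?_⟩
    rw [Subsingleton.elim x 0, h0]
    simp
  · have : ProperSpace E := FiniteDimensional.proper ℝ E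
    obtain ⟨y, hy, hmin⟩ := (isCompact_sphere (0 : E) 1).exists_isMinOn
      (NormedSpace.sphere_nonempty.2 zero_le_one) hq.continuousOn
    have hy1 : ‖y‖ = 1 := by simpa using hy
    refine ⟨q y, pos y (by rintro rfl; simp at hy1), fun x => ?_⟩
    rcases eq_or_ne x 0 with rfl | hx
    · simp [h0]
    · have hx' : ‖x‖ ≠ 0 := norm_ne_zero_iff.2 hx
      have hmem : ‖x‖⁻¹ • x ∈ Metric.sphere (0 : E) 1 := by simp [norm_smul, hx']
      have h1 : q y ≤ q (‖x‖⁻¹ • x) := hmin hmem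
      rw [hom, inv_pow, inv_mul_eq_div, le_div_iff₀ (by positivity)] at h1
      exact h1

end Analysis

/-! ## Algebra valued functions of temperate growth -/

section TemperateSpan

variable {E : Type*} [NormedAddCommGroup E] [NormedSpace ℝ E]
variable {A : Type*} [Ring A] [Algebra ℂ A]

/-- The functions on `E` generated by the elements of `T` over the scalar functions of temperate
growth. -/
def temperateSpan (E : Type*) [NormedAddCommGroup E] [NormedSpace ℝ E] (T : Submodule ℂ A) :
    Submodule ℂ (E → A) :=
  Submodule.span ℂ {F | ∃ m : E → ℂ, m.HasTemperateGrowth ∧ ∃ a ∈ T, F = fun x => m x • a}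

theorem smul_mem_temperateSpan {T : Submodule ℂ A} {m : E → ℂ} (hm : m.HasTemperateGrowth)
    {a : A} (ha : a ∈ T) : (fun x => m x • a) ∈ temperateSpan E T :=
  Submodule.subset_span ⟨m, hm, a, ha, rfl⟩

theorem temperateSpan_mono {S T : Submodule ℂ A} (h : S ≤ T) :
    temperateSpan E S ≤ temperateSpan E T := by
  refine Submodule.span_mono ?_
  rintro _ ⟨m, hm, a, ha, rfl⟩
  exact ⟨m, hm, a, h ha, rfl⟩

theorem mul_mem_temperateSpan {F G : E → A} (hF : F ∈ temperateSpan E (⊤ : Submodule ℂ A))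
    (hG : G ∈ temperateSpan E (⊤ : Submodule ℂ A)) :
    F * G ∈ temperateSpan E (⊤ : Submodule ℂ A) := by
  refine Submodule.span_induction₂ (p := fun F G _ _ => F * G ∈ temperateSpan E ⊤)
    ?_ ?_ ?_ ?_ ?_ ?_ ?_ hF hG
  · rintro _ _ ⟨m, hm, a, -, rfl⟩ ⟨m', hm', a', -, rfl⟩
    convert! smul_mem_temperateSpan (hm.mul hm') (Submodule.mem_top (x := a * a')) using 1
    ext x
    simp [smul_smul, mul_comm]
  · simp
  · simp
  · intro x y z _ _ _ h1 h2
    rw [add_mul]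
    exact add_mem h1 h2
  · intro x y z _ _ _ h1 h2
    rw [mul_add]
    exact add_mem h1 h2
  · intro r x y _ _ h
    rw [smul_mul_assoc]
    exact Submodule.smul_mem _ _ h
  · intro r x y _ _ h
    rw [mul_smul_comm]
    exact Submodule.smul_mem _ _ h

theorem pow_mem_temperateSpan {F : E → A} (hF : F ∈ temperateSpan E (⊤ : Submodule ℂ A)) (i : ℕ) :
    F ^ i ∈ temperateSpan E (⊤ : Submodule ℂ A) := by
  induction i with
  | zero =>
    convert! smul_mem_temperateSpan (E := E) (Function.HasTemperateGrowth.const (1 : ℂ))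
      (Submodule.mem_top (x := (1 : A))) using 1
    ext x
    simp
  | succ i ih =>
    rw [pow_succ]
    exact mul_mem_temperateSpan ih hF

theorem hasTemperateGrowth_of_mem_temperateSpan {T : Submodule ℂ A} {F : E → A}
    (hF : F ∈ temperateSpan E T) (l : A →ₗ[ℂ] ℂ) :
    (fun x => l (F x)).HasTemperateGrowth := by
  induction hF using Submodule.span_induction with
  | mem F h =>
    obtain ⟨m, hm, a, -, rfl⟩ := h
    simp only [map_smul, smul_eq_mul]
    exact hm.mul (.const _)
  | zero => simp
  | add F G _ _ h1 h2 =>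
    simp only [Pi.add_apply, map_add]
    exact h1.add h2
  | smul c F _ h =>
    simp only [Pi.smul_apply, map_smul, smul_eq_mul]
    exact (Function.HasTemperateGrowth.const c).mul h

theorem apply_mem_of_mem_temperateSpan {T : Submodule ℂ A} {F : E → A}
    (hF : F ∈ temperateSpan E T) (x : E) : F x ∈ T := by
  induction hF using Submodule.span_induction with
  | mem F h =>
    obtain ⟨m, -, a, ha, rfl⟩ := h
    exact T.smul_mem _ ha
  | zero => exact T.zero_mem
  | add F G _ _ h1 h2 => exact add_mem h1 h2
  | smul c F _ h => exact T.smul_mem _ h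

/-- The submodule of central nilpotent elements. -/
def centralNilpotents (R A : Type*) [CommRing R] [Ring A] [Algebra R A] : Submodule R A where
  carrier := {a | IsNilpotent a ∧ ∀ b, Commute a b}
  zero_mem' := ⟨IsNilpotent.zero, fun b => Commute.zero_left b⟩
  add_mem' ha hb := ⟨(ha.2 _).isNilpotent_add ha.1 hb.1, fun c => (ha.2 c).add_left (hb.2 c)⟩
  smul_mem' r a ha := ⟨ha.1.smul r, fun b => (ha.2 b).smul_left r⟩

/-- Nilpotency is asserted in the function algebra `E → A`, so that one exponent serves for every
`x`. A generator `m(x) a` inherits the exponent of `a`, and centrality makes sums of such functions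
nilpotent. -/
theorem isNilpotent_of_mem_temperateSpan {T : Submodule ℂ A} (hT : T ≤ centralNilpotents ℂ A)
    {F : E → A} (hF : F ∈ temperateSpan E T) : IsNilpotent F := by
  suffices h : temperateSpan E T ≤ centralNilpotents ℂ (E → A) from (h hF).1
  refine Submodule.span_le.2 ?_
  rintro _ ⟨m, -, a, ha, rfl⟩
  obtain ⟨⟨N, hN⟩, hc⟩ := hT ha
  refine ⟨⟨N, ?_⟩, fun G => ?_⟩
  · ext x
    simp [smul_pow, hN]
  · ext x
    simpa using ((hc (G x)).smul_left (m x)).eq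

end TemperateSpan

/-! ## Near superalgebras -/

section Near

variable {P : Type*} [Ring P] [Algebra ℝ P] (𝒢 : ZMod 2 → Submodule ℝ P) [GradedAlgebra 𝒢]
  [IsNear 𝒢]

/-- With `a = b(y)⁻¹ y`, locality makes `a` or `1 - a` a unit. The second has body zero, which
excludes it. -/
theorem isUnit_of_body_ne_zero {y : P} (hy : body 𝒢 y ≠ 0) : IsUnit y := by
  have : IsLocalRing P := IsNear.isLocal 𝒢
  have h := IsLocalRing.isUnit_or_isUnit_of_add_one
    (add_sub_cancel ((body 𝒢 y)⁻¹ • y) 1)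
  rcases h with h | h
  · exact (isUnit_smul_iff (Units.mk0 _ hy)⁻¹ y).1 h
  · have h2 := h.map (body 𝒢)
    simp [hy] at h2

/-- Write the minimal polynomial of `p` as `T^r g` with `g(0) ≠ 0`. The body of `g(p)` is `g(0)`, so
`g(p)` is a unit, and `p^r g(p) = 0` forces `p^r = 0`. -/
theorem isNilpotent_of_body_eq_zero {p : P} (hp : body 𝒢 p = 0) : IsNilpotent p := by
  have : Module.Finite ℝ P := IsNear.finite 𝒢
  have hne : minpoly ℝ p ≠ 0 := minpoly.ne_zero (Algebra.IsIntegral.isIntegral p)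
  obtain ⟨g, hg, hg0⟩ := Polynomial.exists_eq_pow_rootMultiplicity_mul_and_not_dvd
    (minpoly ℝ p) hne 0
  have hu : IsUnit (Polynomial.aeval p g) := by
    refine isUnit_of_body_ne_zero 𝒢 ?_
    rw [← Polynomial.aeval_algHom_apply, hp, Polynomial.coe_aeval_eq_eval]
    rwa [Polynomial.dvd_iff_isRoot] at hg0
  refine ⟨(minpoly ℝ p).rootMultiplicity 0, ?_⟩
  have h := minpoly.aeval ℝ p
  rw [hg] at h
  simp only [map_mul, map_pow, Polynomial.aeval_X, map_zero, sub_zero] at h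
  exact (hu.mul_left_eq_zero).1 h

end Near

/-! ## Even elements of `Λ ⊗ P` are central -/

section Central

theorem zmod_two_eq (i : ZMod 2) : i = 0 ∨ i = 1 := by
  revert i
  decide

/-- Reconciles the real signs in `IsNear` with the signs in `ℤˣ` used by `GradedTensorProduct`. -/
theorem neg_one_pow_val_smul {W : Type*} [AddCommGroup W] [Module ℝ W] (i j : ZMod 2) (w : W) :
    ((-1 : ℝ) ^ (i.val * j.val)) • w = ((-1 : ℤˣ) ^ (i * j)) • w := by
  rcases zmod_two_eq i with rfl | rfl <;> rcases zmod_two_eq j with rfl | rfl <;>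
    simp [ZMod.val_one, Units.smul_def, uzpow_one, uzpow_zero]

variable {M : Type*} [AddCommGroup M] [Module ℝ M]

theorem ι_mul_eq_involute_mul (v : M) (a : ExteriorAlgebra ℝ M) :
    ExteriorAlgebra.ι ℝ v * a = CliffordAlgebra.involute a * ExteriorAlgebra.ι ℝ v := by
  induction a using ExteriorAlgebra.induction with
  | algebraMap r => rw [AlgHom.commutes, Algebra.commutes]
  | ι w =>
    rw [show CliffordAlgebra.involute (ExteriorAlgebra.ι ℝ w) = -ExteriorAlgebra.ι ℝ w from
      CliffordAlgebra.involute_ι w, neg_mul]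
    exact eq_neg_of_add_eq_zero_left (ExteriorAlgebra.ι_add_mul_swap v w)
  | mul a b ha hb => rw [← mul_assoc, ha, mul_assoc, hb, map_mul, mul_assoc]
  | add a b ha hb => rw [mul_add, ha, hb, map_add, add_mul]

theorem involute_of_mem_evenOdd {Q : QuadraticForm ℝ M} {i : ZMod 2} {a : CliffordAlgebra Q}
    (ha : a ∈ CliffordAlgebra.evenOdd Q i) :
    CliffordAlgebra.involute a = ((-1 : ℤˣ) ^ i) • a := by
  rcases zmod_two_eq i with rfl | rfl
  · rw [CliffordAlgebra.involute_eq_of_mem_even ha, uzpow_zero, one_smul]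
  · rw [CliffordAlgebra.involute_eq_of_mem_odd ha, uzpow_one, Units.neg_smul, one_smul]

variable {P : Type*} [Ring P] [Algebra ℝ P] (𝒢 : ZMod 2 → Submodule ℝ P) [GradedAlgebra 𝒢]

/-- When `a` and `p` have the same parity `i`, the element `a ⊗ p` is even. Against a homogeneous `b
⊗ q`, the signs from `a b = ± b a` and `p q = ± q p` cancel those of the two graded products. -/
theorem commute_tmul [IsNear 𝒢] {ℒ : Type*} [Ring ℒ] [Algebra ℝ ℒ] (𝒜 : ZMod 2 → Submodule ℝ ℒ)
    [GradedAlgebra 𝒜] {i : ZMod 2} {a : ℒ} (ha : a ∈ 𝒜 i)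
    (hcomm : ∀ j, ∀ b ∈ 𝒜 j, a * b = ((-1 : ℤˣ) ^ (i * j)) • (b * a)) {p : P} (hp : p ∈ 𝒢 i)
    (z : GradedTensorProduct ℝ 𝒜 𝒢) :
    Commute (GradedTensorProduct.tmul ℝ a p : GradedTensorProduct ℝ 𝒜 𝒢) z := by
  change (GradedTensorProduct.tmul ℝ a p : GradedTensorProduct ℝ 𝒜 𝒢) * z = z * _
  suffices h : LinearMap.mulLeft ℝ (GradedTensorProduct.tmul ℝ a p : GradedTensorProduct ℝ 𝒜 𝒢) =
      LinearMap.mulRight ℝ (GradedTensorProduct.tmul ℝ a p : GradedTensorProduct ℝ 𝒜 𝒢) from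
    LinearMap.congr_fun h z
  ext b q
  change (GradedTensorProduct.tmul ℝ a p * GradedTensorProduct.tmul ℝ b q :
    GradedTensorProduct ℝ 𝒜 𝒢) = GradedTensorProduct.tmul ℝ b q * GradedTensorProduct.tmul ℝ a p
  induction b using DirectSum.Decomposition.inductionOn 𝒜 with
  | zero => simp [GradedTensorProduct.tmul]
  | add b b' h h' =>
    simp only [GradedTensorProduct.tmul] at h h' ⊢
    simp only [TensorProduct.add_tmul, map_add, mul_add, add_mul, h, h']
  | @homogeneous j b =>
    induction q using DirectSum.Decomposition.inductionOn 𝒢 with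
    | zero => simp [GradedTensorProduct.tmul]
    | add q q' h h' =>
      simp only [GradedTensorProduct.tmul] at h h' ⊢
      simp only [TensorProduct.tmul_add, map_add, mul_add, add_mul, h, h']
    | @homogeneous l q =>
      have h1 := GradedTensorProduct.tmul_coe_mul_coe_tmul 𝒜 𝒢 a ⟨p, hp⟩ b (q : P)
      have h2 := GradedTensorProduct.tmul_coe_mul_coe_tmul 𝒜 𝒢 (b : ℒ) q ⟨a, ha⟩ p
      dsimp only at h1 h2
      rw [h1, h2, hcomm j b b.2, IsNear.superComm (𝒢 := 𝒢) i l p q hp q.2, neg_one_pow_val_smul]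
      rcases zmod_two_eq i with rfl | rfl <;> rcases zmod_two_eq j with rfl | rfl <;>
        rcases zmod_two_eq l with rfl | rfl <;>
        simp [GradedTensorProduct.tmul, TensorProduct.neg_tmul, TensorProduct.tmul_neg]

end Central
/-! ## The soul of `B(v, X v)` -/

section Soul

variable {V : Type*} [AddCommGroup V] [Module ℝ V]
variable {𝒱 : ZMod 2 → Submodule ℝ V} {B : LinearMap.BilinForm ℝ V} {k n : ℕ}
variable {P : Type*} [Ring P] [Algebra ℝ P] (𝒢 : ZMod 2 → Submodule ℝ P) [GradedAlgebra 𝒢]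

theorem ι_mem_oddGrading (d : Module.Dual ℝ (𝒱 1)) :
    (ExteriorAlgebra.ι ℝ d : OddFunctions 𝒱) ∈ oddGrading 𝒱 1 :=
  CliffordAlgebra.ι_mem_evenOdd_one _ d

theorem ι_mul_eq_smul_mul_ι (d : Module.Dual ℝ (𝒱 1)) (j : ZMod 2) (b : OddFunctions 𝒱)
    (hb : b ∈ oddGrading 𝒱 j) :
    ExteriorAlgebra.ι ℝ d * b = ((-1 : ℤˣ) ^ ((1 : ZMod 2) * j)) • (b * ExteriorAlgebra.ι ℝ d) := by
  rw [ι_mul_eq_involute_mul, involute_of_mem_evenOdd hb, one_mul, smul_mul_assoc]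

variable [IsNear 𝒢]

theorem coeffBody_tmul (c : ℂ) (a : OddFunctions 𝒱) (p : P) :
    coeffBody 𝒱 𝒢 (c ⊗ₜ GradedTensorProduct.tmul ℝ a p) =
      c * ((ExteriorAlgebra.algebraMapInv a * body 𝒢 p : ℝ) : ℂ) := by
  simp [coeffBody, mul_comm]

theorem coeffBody_one : coeffBody 𝒱 𝒢 1 = 1 := by
  have h := coeffBody_tmul (𝒱 := 𝒱) 𝒢 1 1 1
  simp only [map_one, mul_one, Complex.ofReal_one] at h
  exact h

theorem coeffBody_algebraMap (c : ℂ) : coeffBody 𝒱 𝒢 (algebraMap ℂ _ c) = c := by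
  rw [Algebra.algebraMap_eq_smul_one, map_smul, coeffBody_one, smul_eq_mul, mul_one]

/-- The central nilpotent elements of `Λ(V_1^*) ⊗ P ⊗ ℂ` with vanishing body. -/
noncomputable def centralSouls (𝒱 : ZMod 2 → Submodule ℝ V) (𝒢 : ZMod 2 → Submodule ℝ P)
    [GradedAlgebra 𝒢] [IsNear 𝒢] : Submodule ℂ (Coeff 𝒱 𝒢) :=
  centralNilpotents ℂ (Coeff 𝒱 𝒢) ⊓ LinearMap.ker (coeffBody 𝒱 𝒢)

theorem one_tmul_mem_centralSouls {a : OddFunctions 𝒱} {p : P}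
    (hn : IsNilpotent (GradedTensorProduct.tmul ℝ a p : RealCoeff 𝒱 𝒢))
    (hc : ∀ z, Commute (GradedTensorProduct.tmul ℝ a p : RealCoeff 𝒱 𝒢) z)
    (hb : ExteriorAlgebra.algebraMapInv a * body 𝒢 p = 0) :
    ((1 : ℂ) ⊗ₜ[ℝ] (GradedTensorProduct.tmul ℝ a p : RealCoeff 𝒱 𝒢)) ∈ centralSouls 𝒱 𝒢 := by
  refine ⟨⟨?_, fun z => ?_⟩, ?_⟩
  · exact hn.map (Algebra.TensorProduct.includeRight : RealCoeff 𝒱 𝒢 →ₐ[ℝ] Coeff 𝒱 𝒢)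
  · induction z using TensorProduct.induction_on with
    | zero => exact Commute.zero_right _
    | add z w hz hw => exact hz.add_right hw
    | tmul c z =>
      change _ * _ = _ * _
      rw [Algebra.TensorProduct.tmul_mul_tmul, Algebra.TensorProduct.tmul_mul_tmul, one_mul,
        mul_one, (hc z).eq]
  · change coeffBody 𝒱 𝒢 _ = 0
    rw [coeffBody_tmul, hb]
    simp

/-- This lemma and the next two cover the kinds of monomial in the soul of `B(v, X v)`: an even soul
`p`, a product `θ p` with `p` odd, and a product `θ θ' p` with `p` even. In the last two, nilpotency
comes from `θ² = 0`. -/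
theorem one_tmul_one_tmul_mem_centralSouls {p : P} (hp : p ∈ 𝒢 0) (hb : body 𝒢 p = 0) :
    ((1 : ℂ) ⊗ₜ[ℝ] (GradedTensorProduct.tmul ℝ 1 p : RealCoeff 𝒱 𝒢)) ∈ centralSouls 𝒱 𝒢 := by
  refine one_tmul_mem_centralSouls 𝒢 ?_ (commute_tmul 𝒢 _ (SetLike.one_mem_graded _) ?_ hp) ?_
  · exact (isNilpotent_of_body_eq_zero 𝒢 hb).map
      (GradedTensorProduct.includeRight (oddGrading 𝒱) 𝒢)
  · intro j b hb
    simp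
  · simp [hb]

theorem one_tmul_ι_tmul_mem_centralSouls (d : Module.Dual ℝ (𝒱 1)) {p : P} (hp : p ∈ 𝒢 1) :
    ((1 : ℂ) ⊗ₜ[ℝ] (GradedTensorProduct.tmul ℝ (ExteriorAlgebra.ι ℝ d) p : RealCoeff 𝒱 𝒢)) ∈
      centralSouls 𝒱 𝒢 := by
  refine one_tmul_mem_centralSouls 𝒢 ?_ (commute_tmul 𝒢 _ (ι_mem_oddGrading d)
    (ι_mul_eq_smul_mul_ι d) hp) ?_
  · refine ⟨2, ?_⟩
    have h := GradedTensorProduct.tmul_coe_mul_coe_tmul (oddGrading 𝒱) 𝒢 (ExteriorAlgebra.ι ℝ d)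
      ⟨p, hp⟩ ⟨_, ι_mem_oddGrading d⟩ p
    dsimp only at h
    rw [pow_two, h, ExteriorAlgebra.ι_sq_zero]
    simp [GradedTensorProduct.tmul]
  · simp [ExteriorAlgebra.algebraMapInv]

theorem one_tmul_ι_mul_ι_tmul_mem_centralSouls (d d' : Module.Dual ℝ (𝒱 1)) {p : P}
    (hp : p ∈ 𝒢 0) :
    ((1 : ℂ) ⊗ₜ[ℝ] (GradedTensorProduct.tmul ℝ (ExteriorAlgebra.ι ℝ d * ExteriorAlgebra.ι ℝ d') p :
      RealCoeff 𝒱 𝒢)) ∈ centralSouls 𝒱 𝒢 := by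
  have hmem : (ExteriorAlgebra.ι ℝ d * ExteriorAlgebra.ι ℝ d' : OddFunctions 𝒱) ∈
    oddGrading 𝒱 0 := CliffordAlgebra.ι_mul_ι_mem_evenOdd_zero _ d d'
  refine one_tmul_mem_centralSouls 𝒢 ?_ (commute_tmul 𝒢 _ hmem (fun j b hb => ?_) hp) ?_
  · refine ⟨2, ?_⟩
    have h := GradedTensorProduct.tmul_coe_mul_coe_tmul (oddGrading 𝒱) 𝒢
      (ExteriorAlgebra.ι ℝ d * ExteriorAlgebra.ι ℝ d') ⟨p, hp⟩ ⟨_, hmem⟩ p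
    have h0 : (ExteriorAlgebra.ι ℝ d * ExteriorAlgebra.ι ℝ d' : OddFunctions 𝒱) *
        (ExteriorAlgebra.ι ℝ d * ExteriorAlgebra.ι ℝ d') = 0 := by
      have h1 := eq_neg_of_add_eq_zero_left (ExteriorAlgebra.ι_add_mul_swap (R := ℝ) d' d)
      rw [mul_assoc, ← mul_assoc (ExteriorAlgebra.ι ℝ d'), h1, neg_mul, mul_assoc,
        ExteriorAlgebra.ι_sq_zero]
      simp
    dsimp only at h
    rw [pow_two, h, h0]
    simp [GradedTensorProduct.tmul]
  · rw [mul_assoc, ι_mul_eq_smul_mul_ι d' j b hb, mul_smul_comm, ← mul_assoc,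
      ι_mul_eq_smul_mul_ι d j b hb, smul_mul_assoc, smul_smul, Int.units_mul_self, one_smul,
      zero_mul, uzpow_zero, one_smul, mul_assoc]
  · simp [ExteriorAlgebra.algebraMapInv]

/-- The quadratic function `G ↦ B(v, G v)` at the point `v` of `𝒱 0` with coordinates `x`. -/
noncomputable def evenForm (e : EvenSymplecticBasis 𝒱 B k) (x : Fin k × Fin 2 → ℝ) :
    Module.End ℝ V →ₗ[ℝ] ℝ where
  toFun G := ∑ i, ∑ j, x j * x i * B (e.e i) (G (e.e j))
  map_add' G G' := by simp [mul_add, Finset.sum_add_distrib]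
  map_smul' r G := by simp [Finset.mul_sum, mul_left_comm]

theorem evenForm_eq (e : EvenSymplecticBasis 𝒱 B k) (x : Fin k × Fin 2 → ℝ) (G : Module.End ℝ V) :
    evenForm e x G = B (∑ i, x i • e.e i : 𝒱 0) (G (∑ i, x i • e.e i : 𝒱 0)) := by
  simp only [evenForm, LinearMap.coe_mk, AddHom.coe_mk, Submodule.coe_sum, Submodule.coe_smul,
    map_sum, map_smul, LinearMap.sum_apply, LinearMap.smul_apply, smul_eq_mul, Finset.mul_sum]
  rw [Finset.sum_comm]
  exact Finset.sum_congr rfl fun i _ => Finset.sum_congr rfl fun j _ => by ring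

/-- The body of `B(v, X v)` as a complex linear function of `X`. -/
noncomputable def bodyForm (e : EvenSymplecticBasis 𝒱 B k) (x : Fin k × Fin 2 → ℝ) :
    ℂ ⊗[ℝ] (Module.End ℝ V ⊗[ℝ] P) →ₗ[ℂ] ℂ :=
  (TensorProduct.AlgebraTensorModule.rid ℝ ℂ ℂ).toLinearMap ∘ₗ
    (evenForm e x).baseChange ℂ ∘ₗ pointBody 𝒢

theorem bodyForm_tmul (e : EvenSymplecticBasis 𝒱 B k) (x : Fin k × Fin 2 → ℝ) (c : ℂ)
    (G : Module.End ℝ V) (p : P) :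
    bodyForm 𝒢 e x (c ⊗ₜ (G ⊗ₜ p)) = c * ((body 𝒢 p * evenForm e x G : ℝ) : ℂ) := by
  have h : bodyForm 𝒢 e x (c ⊗ₜ (G ⊗ₜ p)) =
      TensorProduct.AlgebraTensorModule.rid ℝ ℂ ℂ (c ⊗ₜ[ℝ] evenForm e x (body 𝒢 p • G)) := rfl
  rw [h, TensorProduct.AlgebraTensorModule.rid_tmul, map_smul, smul_eq_mul, Complex.real_smul,
    mul_comm]

theorem one_tmul_smul {W : Type*} [AddCommGroup W] [Module ℝ W] (c : ℝ) (w : W) :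
    (1 : ℂ) ⊗ₜ[ℝ] (c • w) = (c : ℂ) • ((1 : ℂ) ⊗ₜ[ℝ] w) := by
  rw [TensorProduct.smul_tmul', TensorProduct.tmul_smul, TensorProduct.smul_tmul']
  simp

theorem hasTemperateGrowth_ofReal_apply {ι : Type*} [Fintype ι] (i : ι) :
    (fun x : ι → ℝ => (x i : ℂ)).HasTemperateGrowth :=
  (Complex.ofRealCLM.comp (ContinuousLinearMap.proj (R := ℝ) (φ := fun _ : ι => ℝ)
    i)).hasTemperateGrowth

variable (e : EvenSymplecticBasis 𝒱 B k) (f : OddSymplecticBasis 𝒱 B n)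

/-- The four blocks of `quad` are handled separately, each by the same dichotomy. If the parity of
`G` does not match the block, the matrix entry vanishes because `𝒱 0` and `𝒱 1` are orthogonal.
Otherwise the monomial is a central soul. Only this block has a body to subtract. -/
theorem even_even_mem (hB : IsSymplecticForm 𝒱 B) {a : ZMod 2} {G : Module.End ℝ V}
    (hG : G ∈ spo 𝒱 B a) {p : P} (hp : p ∈ 𝒢 a) (i j : Fin k × Fin 2) :
    (fun x : Fin k × Fin 2 → ℝ => (1 : ℂ) ⊗ₜ[ℝ] (B (e.e i) (G (e.e j)) •
      (algebraMap ℝ (RealCoeff 𝒱 𝒢) (x j) *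
        GradedTensorProduct.includeRight (oddGrading 𝒱) 𝒢 p * algebraMap ℝ (RealCoeff 𝒱 𝒢) (x i))) -
      algebraMap ℂ (Coeff 𝒱 𝒢) ((body 𝒢 p * (x j * x i * B (e.e i) (G (e.e j))) : ℝ) : ℂ)) ∈
      temperateSpan (Fin k × Fin 2 → ℝ) (centralSouls 𝒱 𝒢) := by
  rcases zmod_two_eq a with rfl | rfl
  · have hp' : p - algebraMap ℝ P (body 𝒢 p) ∈ 𝒢 0 :=
      sub_mem hp (SetLike.algebraMap_mem_graded _ _)
    have hm := ((hasTemperateGrowth_ofReal_apply j).mul (hasTemperateGrowth_ofReal_apply i)).mul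
      (Function.HasTemperateGrowth.const (B (e.e i) (G (e.e j)) : ℂ))
    convert! smul_mem_temperateSpan hm
      (one_tmul_one_tmul_mem_centralSouls (𝒱 := 𝒱) 𝒢 hp' (by simp)) using 1
    ext x
    have h1 : (1 : ℂ) ⊗ₜ[ℝ] (GradedTensorProduct.tmul ℝ 1 (p - algebraMap ℝ P (body 𝒢 p)) :
        RealCoeff 𝒱 𝒢) = (1 : ℂ) ⊗ₜ[ℝ] GradedTensorProduct.includeRight (oddGrading 𝒱) 𝒢 p -
          (body 𝒢 p : ℂ) • (1 : Coeff 𝒱 𝒢) := by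
      have h2 : (GradedTensorProduct.tmul ℝ 1 (p - algebraMap ℝ P (body 𝒢 p)) :
        RealCoeff 𝒱 𝒢) = GradedTensorProduct.includeRight (oddGrading 𝒱) 𝒢 p - body 𝒢 p • 1 := by
        rw [← Algebra.algebraMap_eq_smul_one,
          ← (GradedTensorProduct.includeRight (oddGrading 𝒱) 𝒢).commutes, ← map_sub]
        rfl
      rw [h2, TensorProduct.tmul_sub, one_tmul_smul]
      rfl
    rw [h1, ← Algebra.commutes, ← mul_assoc, ← map_mul, ← Algebra.smul_def, smul_smul,
      one_tmul_smul, Algebra.algebraMap_eq_smul_one, smul_sub, smul_smul]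
    simp only [Pi.mul_apply]
    push_cast
    congr 2 <;> ring
  · have h0 : B (e.e i) (G (e.e j)) = 0 := hB.even_odd _ (e.e i).2 _ (hG.1 0 _ (e.e j).2)
    simp only [h0, zero_smul, TensorProduct.tmul_zero, mul_zero, Complex.ofReal_zero, map_zero,
      sub_zero]
    exact zero_mem _

theorem even_odd_mem (hB : IsSymplecticForm 𝒱 B) {a : ZMod 2} {G : Module.End ℝ V}
    (hG : G ∈ spo 𝒱 B a) {p : P} (hp : p ∈ 𝒢 a) (i : Fin k × Fin 2) (j : Fin n) :
    (fun x : Fin k × Fin 2 → ℝ => (1 : ℂ) ⊗ₜ[ℝ] (B (e.e i) (G (f.u j)) •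
      (GradedTensorProduct.includeLeft (oddGrading 𝒱) 𝒢 (ExteriorAlgebra.ι ℝ (f.u.coord j)) *
        GradedTensorProduct.includeRight (oddGrading 𝒱) 𝒢 p *
          algebraMap ℝ (RealCoeff 𝒱 𝒢) (x i)))) ∈
      temperateSpan (Fin k × Fin 2 → ℝ) (centralSouls 𝒱 𝒢) := by
  rcases zmod_two_eq a with rfl | rfl
  · have h0 : B (e.e i) (G (f.u j)) = 0 := hB.even_odd _ (e.e i).2 _ (hG.1 1 _ (f.u j).2)
    simp only [h0, zero_smul, TensorProduct.tmul_zero]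
    exact zero_mem _
  · have hm := (hasTemperateGrowth_ofReal_apply i).mul
      (Function.HasTemperateGrowth.const (B (e.e i) (G (f.u j)) : ℂ))
    convert! smul_mem_temperateSpan hm
      (one_tmul_ι_tmul_mem_centralSouls 𝒢 (f.u.coord j) hp) using 1
    ext x
    rw [← Algebra.commutes, ← Algebra.smul_def, smul_smul, one_tmul_smul,
      GradedTensorProduct.includeLeft_apply, GradedTensorProduct.includeRight_apply,
      GradedTensorProduct.tmul_one_mul_one_tmul]
    simp [mul_comm]

theorem odd_even_mem (hB : IsSymplecticForm 𝒱 B) {a : ZMod 2} {G : Module.End ℝ V}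
    (hG : G ∈ spo 𝒱 B a) {p : P} (hp : p ∈ 𝒢 a) (i : Fin n) (j : Fin k × Fin 2) :
    (fun x : Fin k × Fin 2 → ℝ => (1 : ℂ) ⊗ₜ[ℝ] (B (f.u i) (G (e.e j)) •
      (algebraMap ℝ (RealCoeff 𝒱 𝒢) (x j) *
        GradedTensorProduct.includeRight (oddGrading 𝒱) 𝒢 p *
        GradedTensorProduct.includeLeft (oddGrading 𝒱) 𝒢
          (ExteriorAlgebra.ι ℝ (f.u.coord i))))) ∈
      temperateSpan (Fin k × Fin 2 → ℝ) (centralSouls 𝒱 𝒢) := by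
  rcases zmod_two_eq a with rfl | rfl
  · have h0 : B (f.u i) (G (e.e j)) = 0 := hB.odd_even _ (f.u i).2 _ (hG.1 0 _ (e.e j).2)
    simp only [h0, zero_smul, TensorProduct.tmul_zero]
    exact zero_mem _
  -- The minus sign comes from moving the odd `θ` to the left of the odd `p`.
  · have hm := (hasTemperateGrowth_ofReal_apply j).mul
      (Function.HasTemperateGrowth.const (-B (f.u i) (G (e.e j)) : ℂ))
    convert! smul_mem_temperateSpan hm
      (one_tmul_ι_tmul_mem_centralSouls 𝒢 (f.u.coord i) hp) using 1
    ext x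
    have h := GradedTensorProduct.tmul_coe_mul_coe_tmul (oddGrading 𝒱) 𝒢 1
      ⟨p, hp⟩ ⟨_, ι_mem_oddGrading (f.u.coord i)⟩ 1
    simp only [one_mul, mul_one, uzpow_one, Units.neg_smul, one_smul] at h
    rw [mul_assoc, ← Algebra.smul_def, smul_smul, one_tmul_smul,
      GradedTensorProduct.includeLeft_apply, GradedTensorProduct.includeRight_apply, h]
    simp [mul_comm, TensorProduct.tmul_neg]

theorem odd_odd_mem (hB : IsSymplecticForm 𝒱 B) {a : ZMod 2} {G : Module.End ℝ V}
    (hG : G ∈ spo 𝒱 B a) {p : P} (hp : p ∈ 𝒢 a) (i j : Fin n) :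
    (fun _ : Fin k × Fin 2 → ℝ => (1 : ℂ) ⊗ₜ[ℝ] (B (f.u i) (G (f.u j)) •
      (GradedTensorProduct.includeLeft (oddGrading 𝒱) 𝒢 (ExteriorAlgebra.ι ℝ (f.u.coord j)) *
        GradedTensorProduct.includeRight (oddGrading 𝒱) 𝒢 p *
        GradedTensorProduct.includeLeft (oddGrading 𝒱) 𝒢
          (ExteriorAlgebra.ι ℝ (f.u.coord i))))) ∈
      temperateSpan (Fin k × Fin 2 → ℝ) (centralSouls 𝒱 𝒢) := by
  rcases zmod_two_eq a with rfl | rfl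
  · convert! smul_mem_temperateSpan
      (Function.HasTemperateGrowth.const (B (f.u i) (G (f.u j)) : ℂ))
      (one_tmul_ι_mul_ι_tmul_mem_centralSouls 𝒢 (f.u.coord j) (f.u.coord i) hp) using 1
    ext x
    have h := GradedTensorProduct.tmul_coe_mul_coe_tmul (oddGrading 𝒱) 𝒢
      (ExteriorAlgebra.ι ℝ (f.u.coord j)) ⟨p, hp⟩ ⟨_, ι_mem_oddGrading (f.u.coord i)⟩ 1
    simp only [mul_one, uzpow_zero, one_smul] at h
    rw [one_tmul_smul, GradedTensorProduct.includeLeft_apply,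
      GradedTensorProduct.includeRight_apply, GradedTensorProduct.tmul_one_mul_one_tmul,
      GradedTensorProduct.includeLeft_apply, h]
  · have h0 : B (f.u i) (G (f.u j)) = 0 := hB.odd_even _ (f.u i).2 _ (hG.1 1 _ (f.u j).2)
    simp only [h0, zero_smul, TensorProduct.tmul_zero]
    exact zero_mem _

theorem quad_tmul_sub_mem (hB : IsSymplecticForm 𝒱 B) {a : ZMod 2} {G : Module.End ℝ V}
    (hG : G ∈ spo 𝒱 B a) {p : P} (hp : p ∈ 𝒢 a) :
    (fun x => quad 𝒢 e f x (1 ⊗ₜ (G ⊗ₜ p)) -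
      algebraMap ℂ (Coeff 𝒱 𝒢) (bodyForm 𝒢 e x (1 ⊗ₜ (G ⊗ₜ p)))) ∈
      temperateSpan (Fin k × Fin 2 → ℝ) (centralSouls 𝒱 𝒢) := by
  have h := add_mem (add_mem
    (sum_mem fun i (_ : i ∈ Finset.univ) => add_mem
      (sum_mem fun j (_ : j ∈ Finset.univ) => even_even_mem 𝒢 e hB hG hp i j)
      (sum_mem fun j (_ : j ∈ Finset.univ) => even_odd_mem 𝒢 e f hB hG hp i j))
    (sum_mem fun i (_ : i ∈ Finset.univ) =>
      (sum_mem fun j (_ : j ∈ Finset.univ) => odd_even_mem 𝒢 e f hB hG hp i j)))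
    (sum_mem fun i (_ : i ∈ Finset.univ) =>
      (sum_mem fun j (_ : j ∈ Finset.univ) => odd_odd_mem (k := k) 𝒢 f hB hG hp i j))
  convert! h using 1
  ext x
  have hq : quad 𝒢 e f x (1 ⊗ₜ (G ⊗ₜ p)) = (1 : ℂ) ⊗ₜ[ℝ] quadReal 𝒢 e f x (G ⊗ₜ p) := rfl
  have hb : algebraMap ℂ (Coeff 𝒱 𝒢) (bodyForm 𝒢 e x (1 ⊗ₜ (G ⊗ₜ p))) =
      ∑ i, ∑ j, algebraMap ℂ (Coeff 𝒱 𝒢)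
        ((body 𝒢 p * (x j * x i * B (e.e i) (G (e.e j))) : ℝ) : ℂ) := by
    rw [bodyForm_tmul, one_mul]
    simp only [evenForm, LinearMap.coe_mk, AddHom.coe_mk, Finset.mul_sum, Complex.ofReal_sum,
      map_sum]
  rw [hq, hb]
  simp only [quadReal, TensorProduct.lift.tmul, LinearMap.mk₂_apply, Fintype.sum_sum_type,
    realBasis, genericCoord, Sum.elim_inl, Sum.elim_inr, TensorProduct.tmul_add,
    TensorProduct.tmul_sum, Finset.sum_apply, Pi.add_apply, Finset.sum_add_distrib,
    Finset.sum_sub_distrib]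
  abel

/-- Both terms are complex linear in `X`, and `spoPoints` is spanned over `ℂ` by the `1 ⊗ (G ⊗ p)`
with `G` and `p` of equal parity, so pure tensors suffice. -/
theorem quad_sub_mem (hB : IsSymplecticForm 𝒱 B) {X : ℂ ⊗[ℝ] (Module.End ℝ V ⊗[ℝ] P)}
    (hX : X ∈ spoPoints 𝒱 B 𝒢) :
    (fun x => quad 𝒢 e f x X - algebraMap ℂ (Coeff 𝒱 𝒢) (bodyForm 𝒢 e x X)) ∈
      temperateSpan (Fin k × Fin 2 → ℝ) (centralSouls 𝒱 𝒢) := by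
  let Φ : ℂ ⊗[ℝ] (Module.End ℝ V ⊗[ℝ] P) →ₗ[ℂ] (Fin k × Fin 2 → ℝ) → Coeff 𝒱 𝒢 :=
    LinearMap.pi fun x => quad 𝒢 e f x - Algebra.linearMap ℂ (Coeff 𝒱 𝒢) ∘ₗ bodyForm 𝒢 e x
  suffices h : spoPoints 𝒱 B 𝒢 ≤
      (temperateSpan (Fin k × Fin 2 → ℝ) (centralSouls 𝒱 𝒢)).comap Φ from h hX
  rw [spoPoints, Submodule.baseChange_eq_span, Submodule.span_le]
  rintro _ ⟨y, hy, rfl⟩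
  -- Phrased as membership in a real submodule, the claim can be checked on each summand of the
  -- supremum over parities.
  change y ∈ (((temperateSpan (Fin k × Fin 2 → ℝ) (centralSouls 𝒱 𝒢)).comap
    Φ).restrictScalars ℝ).comap (TensorProduct.mk ℝ ℂ (Module.End ℝ V ⊗[ℝ] P) 1)
  revert y
  refine iSup_le (α := Submodule ℝ (Module.End ℝ V ⊗[ℝ] P)) fun a => ?_
  rintro _ ⟨w, rfl⟩
  induction w using TensorProduct.induction_on with
  | zero => simp
  | add w w' h h' =>
    rw [map_add]
    exact add_mem h h'
  | tmul G p => exact quad_tmul_sub_mem 𝒢 e f hB G.2 p.2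

theorem coeffBody_quad (hB : IsSymplecticForm 𝒱 B) {X : ℂ ⊗[ℝ] (Module.End ℝ V ⊗[ℝ] P)}
    (hX : X ∈ spoPoints 𝒱 B 𝒢) (x : Fin k × Fin 2 → ℝ) :
    coeffBody 𝒱 𝒢 (quad 𝒢 e f x X) = bodyForm 𝒢 e x X := by
  have h : coeffBody 𝒱 𝒢 _ = 0 :=
    (apply_mem_of_mem_temperateSpan (quad_sub_mem 𝒢 e f hB hX) x).2
  rwa [map_sub, coeffBody_algebraMap, sub_eq_zero] at h

end Soul
/-! ## Rescaling of the odd variables -/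

section Rescaling

variable {M : Type*} [AddCommGroup M] [Module ℝ M]

/-- The chain rule for `θ ↦ s θ`, obtained from the Leibniz rule by induction on products of
generators. -/
theorem contractLeft_map_smul (s : ℝ) (d : Module.Dual ℝ M) (φ : ExteriorAlgebra ℝ M) :
    CliffordAlgebra.contractLeft (Q := (0 : QuadraticForm ℝ M)) d
        (ExteriorAlgebra.map (s • LinearMap.id) φ) =
      s • ExteriorAlgebra.map (s • LinearMap.id)
        (CliffordAlgebra.contractLeft (Q := (0 : QuadraticForm ℝ M)) d φ) := by
  induction φ using CliffordAlgebra.left_induction with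
  | algebraMap r =>
    rw [AlgHom.commutes, CliffordAlgebra.contractLeft_algebraMap, map_zero, smul_zero]
  | add a b ha hb => rw [map_add, map_add, ha, hb, map_add, map_add, smul_add]
  | ι_mul a v ha =>
    have h : ExteriorAlgebra.map (s • LinearMap.id) (CliffordAlgebra.ι (0 : QuadraticForm ℝ M) v) =
      s • CliffordAlgebra.ι (0 : QuadraticForm ℝ M) v := by
      exact (ExteriorAlgebra.map_apply_ι (s • LinearMap.id) v).trans (map_smul _ s v)
    rw [map_mul, h, smul_mul_assoc, map_smul, CliffordAlgebra.contractLeft_ι_mul, ha,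
      CliffordAlgebra.contractLeft_ι_mul, map_sub, map_smul, map_mul, h, smul_mul_assoc,
      mul_smul_comm]

theorem prod_contractLeft_map_smul (s : ℝ) (l : List (Module.Dual ℝ M)) (φ : ExteriorAlgebra ℝ M) :
    (l.map fun d => (CliffordAlgebra.contractLeft (Q := (0 : QuadraticForm ℝ M)) d :
        Module.End ℝ (ExteriorAlgebra ℝ M))).prod (ExteriorAlgebra.map (s • LinearMap.id) φ) =
      s ^ l.length • ExteriorAlgebra.map (s • LinearMap.id)
        ((l.map fun d => (CliffordAlgebra.contractLeft (Q := (0 : QuadraticForm ℝ M)) d :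
          Module.End ℝ (ExteriorAlgebra ℝ M))).prod φ) := by
  induction l with
  | nil => simp
  | cons d l ih =>
    simp only [List.map_cons, List.prod_cons, Module.End.mul_apply, List.length_cons]
    rw [ih, map_smul, contractLeft_map_smul, smul_smul, pow_succ]

theorem algebraMapInv_map_smul (s : ℝ) (φ : ExteriorAlgebra ℝ M) :
    ExteriorAlgebra.algebraMapInv (ExteriorAlgebra.map (s • LinearMap.id) φ) =
      ExteriorAlgebra.algebraMapInv φ := by
  suffices h : (ExteriorAlgebra.algebraMapInv (R := ℝ) (M := M)).comp
      (ExteriorAlgebra.map (s • LinearMap.id)) = ExteriorAlgebra.algebraMapInv from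
    AlgHom.congr_fun h φ
  ext v
  simp [ExteriorAlgebra.algebraMapInv]

variable {V : Type*} [AddCommGroup V] [Module ℝ V]
variable {𝒱 : ZMod 2 → Submodule ℝ V} {B : LinearMap.BilinForm ℝ V} {k n : ℕ}
variable {P : Type*} [Ring P] [Algebra ℝ P]

/-- Each of the `n` derivatives yields one factor `s`, and the scalar part taken at the end is
unaffected by the dilation. This is the source of `sⁿ`. -/
theorem topDeriv_map_smul (f : OddSymplecticBasis 𝒱 B n) (s : ℝ) (φ : OddFunctions 𝒱) :
    topDeriv f (ExteriorAlgebra.map (s • LinearMap.id) φ) = s ^ n * topDeriv f φ := by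
  have h := prod_contractLeft_map_smul s
    (List.ofFn fun j => Module.Dual.eval ℝ (𝒱 1) (f.u j)) φ
  simp only [List.map_ofFn, List.length_ofFn] at h
  have h2 := congrArg ExteriorAlgebra.algebraMapInv h
  rw [map_smul, algebraMapInv_map_smul] at h2
  exact h2

variable (𝒢 : ZMod 2 → Submodule ℝ P) [GradedAlgebra 𝒢]

/-- Preservation of parity ensures that the rescaled elements still obey the rule of signs against
`P`, as the construction of `realRescale` requires. -/
theorem map_smul_mem_oddGrading (s : ℝ) {i : ZMod 2} {a : OddFunctions 𝒱}
    (ha : a ∈ oddGrading 𝒱 i) :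
    ExteriorAlgebra.map (s • LinearMap.id) a ∈ oddGrading 𝒱 i := by
  have hpair (m₁ m₂ : Module.Dual ℝ (𝒱 1)) (b : OddFunctions 𝒱) (i : ZMod 2)
      (hb : ExteriorAlgebra.map (s • LinearMap.id) b ∈ oddGrading 𝒱 i) :
      ExteriorAlgebra.map (s • LinearMap.id)
        (ExteriorAlgebra.ι ℝ m₁ * ExteriorAlgebra.ι ℝ m₂ * b) ∈ oddGrading 𝒱 i := by
    rw [map_mul, map_mul, ExteriorAlgebra.map_apply_ι, ExteriorAlgebra.map_apply_ι]
    have h := SetLike.mul_mem_graded (CliffordAlgebra.ι_mul_ι_mem_evenOdd_zero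
      (0 : QuadraticForm ℝ (Module.Dual ℝ (𝒱 1))) ((s • LinearMap.id : _ →ₗ[ℝ] _) m₁)
      ((s • LinearMap.id : _ →ₗ[ℝ] _) m₂)) hb
    rwa [zero_add] at h
  rcases zmod_two_eq i with rfl | rfl
  · induction a, ha using CliffordAlgebra.even_induction with
    | algebraMap r =>
      rw [AlgHom.commutes]
      exact SetLike.algebraMap_mem_graded (oddGrading 𝒱) r
    | add x y hx hy ihx ihy =>
      rw [map_add]
      exact add_mem ihx ihy
    | ι_mul_ι_mul m₁ m₂ x hx ih => exact hpair m₁ m₂ x 0 ih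
  · induction a, ha using CliffordAlgebra.odd_induction with
    | ι v =>
      change ExteriorAlgebra.map _ (ExteriorAlgebra.ι ℝ v) ∈ _
      rw [ExteriorAlgebra.map_apply_ι]
      exact ι_mem_oddGrading _
    | add x y hx hy ihx ihy =>
      rw [map_add]
      exact add_mem ihx ihy
    | ι_mul_ι_mul m₁ m₂ x hx ih => exact hpair m₁ m₂ x 1 ih

/-- The endomorphism of `Λ(V_1^*) ⊗ P` multiplying the generators `θ` by `s`. -/
noncomputable def realRescale (𝒱 : ZMod 2 → Submodule ℝ V) (s : ℝ) :
    RealCoeff 𝒱 𝒢 →ₐ[ℝ] RealCoeff 𝒱 𝒢 :=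
  GradedTensorProduct.lift (oddGrading 𝒱) 𝒢
    ((GradedTensorProduct.includeLeft (oddGrading 𝒱) 𝒢).comp
      (ExteriorAlgebra.map (s • LinearMap.id)))
    (GradedTensorProduct.includeRight (oddGrading 𝒱) 𝒢) fun i j a b => by
      have h := GradedTensorProduct.tmul_coe_mul_coe_tmul (oddGrading 𝒱) 𝒢 1 b
        ⟨_, map_smul_mem_oddGrading s a.2⟩ 1
      simp only [one_mul, mul_one] at h
      simp only [AlgHom.comp_apply, GradedTensorProduct.includeLeft_apply,
        GradedTensorProduct.includeRight_apply]
      rw [h, GradedTensorProduct.tmul_one_mul_one_tmul, smul_smul, Int.units_mul_self, one_smul]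

theorem realRescale_tmul (s : ℝ) (a : OddFunctions 𝒱) (p : P) :
    realRescale 𝒢 𝒱 s (GradedTensorProduct.tmul ℝ a p) =
      GradedTensorProduct.tmul ℝ (ExteriorAlgebra.map (s • LinearMap.id) a) p := by
  rw [realRescale, GradedTensorProduct.lift_tmul]
  exact GradedTensorProduct.tmul_one_mul_one_tmul _ _ _ _

/-- The endomorphism of `Λ(V_1^*) ⊗ P ⊗ ℂ` multiplying the generators `θ` by `s`. -/
noncomputable def rescale (𝒱 : ZMod 2 → Submodule ℝ V) (s : ℝ) :
    Coeff 𝒱 𝒢 →ₐ[ℂ] Coeff 𝒱 𝒢 :=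
  Algebra.TensorProduct.map (AlgHom.id ℂ ℂ) (realRescale 𝒢 𝒱 s)

theorem coeff_hom_ext {W : Type*} [AddCommGroup W] [Module ℂ W] {φ ψ : Coeff 𝒱 𝒢 →ₗ[ℂ] W}
    (h : ∀ (a : OddFunctions 𝒱) (p : P),
      φ (1 ⊗ₜ GradedTensorProduct.tmul ℝ a p) = ψ (1 ⊗ₜ GradedTensorProduct.tmul ℝ a p)) :
    φ = ψ := by
  refine LinearMap.ext fun z => ?_
  induction z using TensorProduct.induction_on with
  | zero => simp
  | add z w hz hw => rw [map_add, map_add, hz, hw]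
  | tmul c y =>
    have hc (y : RealCoeff 𝒱 𝒢) : c ⊗ₜ[ℝ] y = c • ((1 : ℂ) ⊗ₜ[ℝ] y) := by
      rw [TensorProduct.smul_tmul', smul_eq_mul, mul_one]
    rw [hc, map_smul, map_smul]
    congr 1
    obtain ⟨y, rfl⟩ := (GradedTensorProduct.of ℝ (oddGrading 𝒱) 𝒢).surjective y
    induction y using TensorProduct.induction_on with
    | zero => simp
    | add y z hy hz => simp only [map_add, TensorProduct.tmul_add, hy, hz]
    | tmul a p => exact h a p

theorem rescale_tmul (s : ℝ) (c : ℂ) (a : OddFunctions 𝒱) (p : P) :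
    rescale 𝒢 𝒱 s (c ⊗ₜ GradedTensorProduct.tmul ℝ a p) =
      c ⊗ₜ GradedTensorProduct.tmul ℝ (ExteriorAlgebra.map (s • LinearMap.id) a) p := by
  rw [rescale, Algebra.TensorProduct.map_tmul, realRescale_tmul]
  rfl

theorem coeffBody_rescale [IsNear 𝒢] (s : ℝ) (α : Coeff 𝒱 𝒢) :
    coeffBody 𝒱 𝒢 (rescale 𝒢 𝒱 s α) = coeffBody 𝒱 𝒢 α := by
  suffices h : coeffBody 𝒱 𝒢 ∘ₗ (rescale 𝒢 𝒱 s).toLinearMap = coeffBody 𝒱 𝒢 from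
    LinearMap.congr_fun h α
  refine coeff_hom_ext 𝒢 fun a p => ?_
  rw [LinearMap.comp_apply, AlgHom.toLinearMap_apply, rescale_tmul, coeffBody_tmul, coeffBody_tmul,
    algebraMapInv_map_smul]

theorem oddIntegral_tmul (f : OddSymplecticBasis 𝒱 B n) (a : OddFunctions 𝒱) (p : P) :
    oddIntegral 𝒢 f (1 ⊗ₜ GradedTensorProduct.tmul ℝ a p) =
      (∏ j, f.c j) • ((1 : ℂ) ⊗ₜ[ℝ] (topDeriv f a • p)) := rfl

theorem oddIntegral_rescale (f : OddSymplecticBasis 𝒱 B n) (s : ℝ) (α : Coeff 𝒱 𝒢) :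
    oddIntegral 𝒢 f (rescale 𝒢 𝒱 s α) = ((s ^ n : ℝ) : ℂ) • oddIntegral 𝒢 f α := by
  suffices h : oddIntegral 𝒢 f ∘ₗ (rescale 𝒢 𝒱 s).toLinearMap =
      ((s ^ n : ℝ) : ℂ) • oddIntegral 𝒢 f from LinearMap.congr_fun h α
  refine coeff_hom_ext 𝒢 fun a p => ?_
  rw [LinearMap.comp_apply, AlgHom.toLinearMap_apply, rescale_tmul, LinearMap.smul_apply,
    oddIntegral_tmul, oddIntegral_tmul, topDeriv_map_smul, mul_smul, one_tmul_smul, smul_comm]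

/-- An algebra homomorphism commutes with the finite exponential series of a nilpotent element, and
`rescale` preserves the body. -/
theorem superExp_rescale [IsNear 𝒢] (s : ℝ) (α : Coeff 𝒱 𝒢)
    (hα : IsNilpotent (α - algebraMap ℂ (Coeff 𝒱 𝒢) (coeffBody 𝒱 𝒢 α))) :
    superExp 𝒱 𝒢 (rescale 𝒢 𝒱 s α) = rescale 𝒢 𝒱 s (superExp 𝒱 𝒢 α) := by
  rw [superExp, superExp, coeffBody_rescale, map_smul, IsNilpotent.map_exp hα, map_sub,
    AlgHom.commutes]

/-- An even coordinate gains its factor `s` from the base point `s • x`, an odd one from the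
substitution `θ ↦ s θ`. Together they dilate the whole generic point, which makes `rescale_quad` a
consequence of the degree two of `quad` in the coordinates. -/
theorem realRescale_genericCoord (f : OddSymplecticBasis 𝒱 B n) (s : ℝ) (x : Fin k × Fin 2 → ℝ)
    (i : (Fin k × Fin 2) ⊕ Fin n) :
    realRescale 𝒢 𝒱 s (genericCoord 𝒢 f (s • x) i) = s • genericCoord 𝒢 f x i := by
  rcases i with i | j
  · simp [genericCoord, Algebra.smul_def]
  · simp only [genericCoord, Sum.elim_inr, GradedTensorProduct.includeLeft_apply]
    rw [realRescale_tmul, ExteriorAlgebra.map_apply_ι]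
    rw [LinearMap.smul_apply, LinearMap.id_apply, map_smul, GradedTensorProduct.tmul,
      ← TensorProduct.smul_tmul', map_smul]

theorem rescale_quad (e : EvenSymplecticBasis 𝒱 B k) (f : OddSymplecticBasis 𝒱 B n) (s : ℝ)
    (x : Fin k × Fin 2 → ℝ) (X : ℂ ⊗[ℝ] (Module.End ℝ V ⊗[ℝ] P)) :
    rescale 𝒢 𝒱 s (quad 𝒢 e f (s • x) X) = quad 𝒢 e f x (((s ^ 2 : ℝ) : ℂ) • X) := by
  rw [map_smul]
  induction X using TensorProduct.induction_on with
  | zero => simp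
  | add X Y hX hY => simp only [map_add, smul_add, hX, hY]
  | tmul c y =>
    have h : realRescale 𝒢 𝒱 s (quadReal 𝒢 e f (s • x) y) = s ^ 2 • quadReal 𝒢 e f x y := by
      induction y using TensorProduct.induction_on with
      | zero => simp
      | add X Y hX hY => simp only [map_add, smul_add, hX, hY]
      | tmul G p =>
        have hp : realRescale 𝒢 𝒱 s (GradedTensorProduct.includeRight (oddGrading 𝒱) 𝒢 p) =
            GradedTensorProduct.includeRight (oddGrading 𝒱) 𝒢 p := by
          rw [GradedTensorProduct.includeRight_apply, realRescale_tmul, map_one]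
        simp only [quadReal, TensorProduct.lift.tmul, LinearMap.mk₂_apply, map_sum, map_smul,
          map_mul, realRescale_genericCoord, hp, Finset.smul_sum, smul_mul_assoc, mul_smul_comm,
          smul_smul]
        exact Finset.sum_congr rfl fun i _ => Finset.sum_congr rfl fun j _ => by ring_nf
    have h1 : rescale 𝒢 𝒱 s (quad 𝒢 e f (s • x) (c ⊗ₜ y)) =
      c ⊗ₜ[ℝ] realRescale 𝒢 𝒱 s (quadReal 𝒢 e f (s • x) y) := rfl
    have h2 : quad 𝒢 e f x (c ⊗ₜ y) = c ⊗ₜ[ℝ] quadReal 𝒢 e f x y := rfl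
    rw [h1, h, h2, TensorProduct.tmul_smul, TensorProduct.smul_tmul', TensorProduct.smul_tmul',
      Complex.real_smul, smul_eq_mul]

end Rescaling
/-! ## Convergence and homogeneity -/

section Main

variable {V : Type*} [AddCommGroup V] [Module ℝ V]
variable {𝒱 : ZMod 2 → Submodule ℝ V} {B : LinearMap.BilinForm ℝ V} {k n : ℕ}
variable {P : Type*} [Ring P] [Algebra ℝ P] (𝒢 : ZMod 2 → Submodule ℝ P) [GradedAlgebra 𝒢]
variable (e : EvenSymplecticBasis 𝒱 B k) (f : OddSymplecticBasis 𝒱 B n)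

theorem ofReal_smul_tensor {W : Type*} [AddCommGroup W] [Module ℝ W] (r : ℝ) (w : ℂ ⊗[ℝ] W) :
    (r : ℂ) • w = r • w :=
  algebraMap_smul ℂ r w

theorem continuous_evenForm (G : Module.End ℝ V) : Continuous fun x => evenForm e x G := by
  simp only [evenForm, LinearMap.coe_mk, AddHom.coe_mk]
  fun_prop

theorem exists_mul_norm_sq_le_evenForm {Y : Module.End ℝ V} (hY : Y ∈ posCone 𝒱 B) :
    ∃ c : ℝ, 0 < c ∧ ∀ x, c * ‖x‖ ^ 2 ≤ evenForm e x Y := by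
  refine exists_mul_norm_sq_le (continuous_evenForm e Y) (fun t x => ?_) fun x hx => ?_
  · simp only [evenForm, LinearMap.coe_mk, AddHom.coe_mk, Pi.smul_apply, smul_eq_mul,
      Finset.mul_sum]
    exact Finset.sum_congr rfl fun i _ => Finset.sum_congr rfl fun j _ => by ring
  · rw [evenForm_eq]
    refine hY.2 _ (Submodule.coe_mem _) ?_
    rw [← e.e.equivFun_symm_apply]
    simpa only [ne_eq, ZeroMemClass.coe_eq_zero, EmbeddingLike.map_eq_zero_iff] using hx

variable [IsNear 𝒢]

theorem bodyForm_of_pointBody_eq {X : ℂ ⊗[ℝ] (Module.End ℝ V ⊗[ℝ] P)} {Y Z : Module.End ℝ V}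
    (h : pointBody 𝒢 X = (1 : ℂ) ⊗ₜ[ℝ] Y + Complex.I ⊗ₜ[ℝ] Z) (x : Fin k × Fin 2 → ℝ) :
    bodyForm 𝒢 e x X = evenForm e x Y + evenForm e x Z * Complex.I := by
  simp [bodyForm, h]

theorem soul_mem (hB : IsSymplecticForm 𝒱 B) {X : ℂ ⊗[ℝ] (Module.End ℝ V ⊗[ℝ] P)}
    (hX : X ∈ spoPoints 𝒱 B 𝒢) (c : ℂ) :
    (fun x => c • quad 𝒢 e f x X -
      algebraMap ℂ (Coeff 𝒱 𝒢) (coeffBody 𝒱 𝒢 (c • quad 𝒢 e f x X))) ∈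
      temperateSpan (Fin k × Fin 2 → ℝ) (centralSouls 𝒱 𝒢) := by
  convert! Submodule.smul_mem _ c (quad_sub_mem 𝒢 e f hB hX) using 1
  ext x
  rw [Pi.smul_apply, map_smul, coeffBody_quad 𝒢 e f hB hX, smul_sub, smul_eq_mul,
    map_mul, Algebra.smul_def c (algebraMap ℂ (Coeff 𝒱 𝒢) _)]

theorem isNilpotent_soul (hB : IsSymplecticForm 𝒱 B) {X : ℂ ⊗[ℝ] (Module.End ℝ V ⊗[ℝ] P)}
    (hX : X ∈ spoPoints 𝒱 B 𝒢) (c : ℂ) :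
    IsNilpotent (fun x => c • quad 𝒢 e f x X -
      algebraMap ℂ (Coeff 𝒱 𝒢) (coeffBody 𝒱 𝒢 (c • quad 𝒢 e f x X))) :=
  isNilpotent_of_mem_temperateSpan inf_le_left (soul_mem 𝒢 e f hB hX c)

/-- The uniform nilpotency exponent `K` turns the exponential into one polynomial in the soul, of
the same length for all `x`. Powers of the soul stay in the span over `⊤`. -/
theorem exists_mem_temperateSpan_exp_soul (hB : IsSymplecticForm 𝒱 B)
    {X : ℂ ⊗[ℝ] (Module.End ℝ V ⊗[ℝ] P)} (hX : X ∈ spoPoints 𝒱 B 𝒢) (c : ℂ) :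
    (fun x => IsNilpotent.exp (c • quad 𝒢 e f x X -
      algebraMap ℂ (Coeff 𝒱 𝒢) (coeffBody 𝒱 𝒢 (c • quad 𝒢 e f x X)))) ∈
      temperateSpan (Fin k × Fin 2 → ℝ) (⊤ : Submodule ℂ (Coeff 𝒱 𝒢)) := by
  obtain ⟨K, hK⟩ := isNilpotent_soul 𝒢 e f hB hX c
  have hmem := temperateSpan_mono le_top (soul_mem 𝒢 e f hB hX c)
  have hsum := sum_mem fun i (_ : i ∈ Finset.range K) =>
    Submodule.smul_mem _ ((((i.factorial : ℚ)⁻¹ : ℚ)) : ℂ) (pow_mem_temperateSpan hmem i)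
  convert! hsum using 1
  ext x
  rw [IsNilpotent.exp_eq_sum (congrFun hK x), Finset.sum_apply]
  refine Finset.sum_congr rfl fun i _ => ?_
  rw [Pi.smul_apply, Pi.pow_apply, Rat.cast_smul_eq_qsmul]

theorem vIntegrable_spfIntegrand (hB : IsSymplecticForm 𝒱 B)
    {X : ℂ ⊗[ℝ] (Module.End ℝ V ⊗[ℝ] P)} (hX : X ∈ tubePoints 𝒱 B 𝒢) :
    VIntegrable (spfIntegrand 𝒢 e f X) := by
  obtain ⟨hX, Y, hY, Z, -, hYZ⟩ := hX
  intro l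
  obtain ⟨c, hc, hcY⟩ := exists_mul_norm_sq_le_evenForm e hY
  have hb (x : Fin k × Fin 2 → ℝ) : coeffBody 𝒱 𝒢 (-(1 / 2 : ℂ) • quad 𝒢 e f x X) =
      -(1 / 2 : ℂ) * (evenForm e x Y + evenForm e x Z * Complex.I) := by
    rw [map_smul, coeffBody_quad 𝒢 e f hB hX, bodyForm_of_pointBody_eq 𝒢 e hYZ, smul_eq_mul]
  have h := integrable_exp_mul_of_hasTemperateGrowth
    (hasTemperateGrowth_of_mem_temperateSpan
      (exists_mem_temperateSpan_exp_soul 𝒢 e f hB hX (-(1 / 2 : ℂ))) (l ∘ₗ oddIntegral 𝒢 f))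
    (b := fun x => -(1 / 2 : ℂ) * (evenForm e x Y + evenForm e x Z * Complex.I))
    (by
      have h1 := continuous_evenForm e Y
      have h2 := continuous_evenForm e Z
      fun_prop)
    -- The term in `Z` is purely imaginary here, so the real part is `-½ B(v, Y v) ≤ -(c / 2) ‖x‖²`.
    (half_pos hc) (fun x => by
      have := hcY x
      simp
      linarith)
  convert! h using 1
  ext x
  rw [spfIntegrand, superExp, hb, map_smul, map_smul, smul_eq_mul]
  rfl

theorem smul_mem_tubePoints {X : ℂ ⊗[ℝ] (Module.End ℝ V ⊗[ℝ] P)} (hX : X ∈ tubePoints 𝒱 B 𝒢)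
    {r : ℝ} (hr : 0 < r) : r • X ∈ tubePoints 𝒱 B 𝒢 := by
  obtain ⟨hX, Y, hY, Z, hZ, hYZ⟩ := hX
  have hrX : r • X = (r : ℂ) • X := (ofReal_smul_tensor r X).symm
  refine ⟨?_, r • Y, ⟨Submodule.smul_mem _ _ hY.1, fun v hv hv0 => ?_⟩, r • Z,
    Submodule.smul_mem _ _ hZ, ?_⟩
  · rw [hrX]
    exact Submodule.smul_mem _ _ hX
  · rw [LinearMap.smul_apply, map_smul, smul_eq_mul]
    exact mul_pos hr (hY.2 v hv hv0)
  · rw [hrX, map_smul, hYZ, smul_add, ofReal_smul_tensor, ofReal_smul_tensor, TensorProduct.tmul_smul,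
      TensorProduct.tmul_smul]

/-- By `rescale_quad`, the exponent for `s² X` at `x` is the rescaled exponent for `X` at `s • x`.
The dilation passes through the exponential and leaves the Berezin integral as the factor `sⁿ`. -/
theorem spfIntegrand_sq_smul (hB : IsSymplecticForm 𝒱 B)
    {X : ℂ ⊗[ℝ] (Module.End ℝ V ⊗[ℝ] P)} (hX : X ∈ spoPoints 𝒱 B 𝒢) (s : ℝ)
    (x : Fin k × Fin 2 → ℝ) :
    spfIntegrand 𝒢 e f (s ^ 2 • X) x = ((s ^ n : ℝ) : ℂ) • spfIntegrand 𝒢 e f X (s • x) := by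
  obtain ⟨K, hK⟩ := isNilpotent_soul 𝒢 e f hB hX (-(1 / 2 : ℂ))
  have hsX : s ^ 2 • X = ((s ^ 2 : ℝ) : ℂ) • X := (ofReal_smul_tensor (s ^ 2) X).symm
  rw [spfIntegrand, hsX, ← rescale_quad, ← map_smul, superExp_rescale 𝒢 s _
    ⟨K, congrFun hK (s • x)⟩, oddIntegral_rescale, spfIntegrand]

theorem vIntegral_smul_comp_smul {W : Type*} [AddCommGroup W] [Module ℂ W] [Module.Finite ℂ W]
    {E : Type*} [NormedAddCommGroup E] [NormedSpace ℝ E] [FiniteDimensional ℝ E]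
    [MeasureTheory.MeasureSpace E] [BorelSpace E]
    [(MeasureTheory.volume : MeasureTheory.Measure E).IsAddHaarMeasure] (F : E → W) (c : ℂ)
    {s : ℝ} (hs : 0 ≤ s) :
    vIntegral (fun x => c • F (s • x)) =
      (c * (((s ^ Module.finrank ℝ E)⁻¹ : ℝ) : ℂ)) • vIntegral F := by
  simp only [vIntegral, Finset.smul_sum]
  refine Finset.sum_congr rfl fun i _ => ?_
  simp only [map_smul, Finsupp.smul_apply, smul_eq_mul]
  rw [MeasureTheory.integral_const_mul, MeasureTheory.Measure.integral_comp_smul_of_nonneg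
    MeasureTheory.volume (fun x => (Module.finBasis ℂ W).repr (F x) i) s (hR := hs), smul_smul,
    Complex.real_smul, mul_assoc]

/-- Convergence plays no part: dilation preserves integrability of each coordinate, and a divergent
coordinate integral has the default value zero on both sides. -/
theorem spf_sq_smul (hB : IsSymplecticForm 𝒱 B)
    {X : ℂ ⊗[ℝ] (Module.End ℝ V ⊗[ℝ] P)} (hX : X ∈ spoPoints 𝒱 B 𝒢) {s : ℝ} (hs : 0 < s) :
    spf 𝒢 e f (s ^ 2 • X) = (s ^ n * (s ^ (k * 2))⁻¹) • spf 𝒢 e f X := by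
  have h : spfIntegrand 𝒢 e f (s ^ 2 • X) =
      fun x => ((s ^ n : ℝ) : ℂ) • spfIntegrand 𝒢 e f X (s • x) :=
    funext fun x => spfIntegrand_sq_smul 𝒢 e f hB hX s x
  have : Module.Finite ℝ P := IsNear.finite 𝒢
  rw [spf, spf, h, vIntegral_smul_comp_smul _ _ hs.le, smul_comm (_ * _ : ℝ)]
  congr 1
  rw [← Complex.ofReal_mul, ofReal_smul_tensor]
  simp

end Main

end SuperPfaffian

theorem mainTheorem11
    {V : Type*} [AddCommGroup V] [Module ℝ V] [FiniteDimensional ℝ V]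
    (𝒱 : ZMod 2 → Submodule ℝ V) (h𝒱 : DirectSum.IsInternal 𝒱)
    (B : LinearMap.BilinForm ℝ V) (hB : SuperPfaffian.IsSymplecticForm 𝒱 B)
    {k n : ℕ} (e : SuperPfaffian.EvenSymplecticBasis 𝒱 B k)
    (f : SuperPfaffian.OddSymplecticBasis 𝒱 B n)
    {P : Type*} [Ring P] [Algebra ℝ P] (𝒢 : ZMod 2 → Submodule ℝ P) [GradedAlgebra 𝒢]
    [SuperPfaffian.IsNear 𝒢]
    (X : TensorProduct ℝ ℂ (TensorProduct ℝ (Module.End ℝ V) P))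
    (hX : X ∈ SuperPfaffian.tubePoints 𝒱 B 𝒢) (r : ℝ) (hr : 0 < r) :
    SuperPfaffian.VIntegrable (SuperPfaffian.spfIntegrand 𝒢 e f X) ∧
    r • X ∈ SuperPfaffian.tubePoints 𝒱 B 𝒢 ∧
    SuperPfaffian.spf 𝒢 e f (r • X) =
      (r ^ (((Module.finrank ℝ (𝒱 1) : ℝ) - (Module.finrank ℝ (𝒱 0) : ℝ)) / 2)) •
        SuperPfaffian.spf 𝒢 e f X := by
  refine ⟨SuperPfaffian.vIntegrable_spfIntegrand 𝒢 e f hB hX,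
    SuperPfaffian.smul_mem_tubePoints 𝒢 hX hr, ?_⟩
  -- The scaling identity concerns squares, so it is applied at `s = √r`. The halved exponent arises
  -- from `√r = r^(1/2)`.
  have hs : 0 < Real.sqrt r := Real.sqrt_pos.2 hr
  have h := SuperPfaffian.spf_sq_smul 𝒢 e f hB hX.1 hs
  rw [Real.sq_sqrt hr.le] at h
  rw [h]
  congr 1
  have h0 : Module.finrank ℝ (𝒱 0) = k * 2 := by simp [Module.finrank_eq_card_basis e.e]
  have h1 : Module.finrank ℝ (𝒱 1) = n := by simp [Module.finrank_eq_card_basis f.u]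
  rw [h0, h1, ← div_eq_mul_inv, ← Real.rpow_natCast, ← Real.rpow_natCast, ← Real.rpow_sub hs,
    Real.sqrt_eq_rpow, ← Real.rpow_mul hr.le]
  congr 1
  ring
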